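/- Let $\mathcal X\subset\mathbb R^d$, $\mathcal Y\subset\mathbb R$, let $\rho$ be a probability measure on $\mathcal Z=\mathcal X\times\mathcal Y$, let $K:\mathcal X\times\mathcal X\to\mathbb R$ be a Mercer kernel (continuous, symmetric, positive semi-definite) with $\kappa:=\sup_{x\in\mathcal X}\sqrt{K(x,x)}<\infty$, and let $H_K$ be its reproducing kernel Hilbert space, with $K_x=K(x,\cdot)\in H_K$. Let $\alpha\in(0,1]$, $L>0$, and let $\phi:\mathcal Y\times\mathbb R\to[0,\infty)$ be a measurable loss function that is convex and differentiable in its second argument, with derivative $\phi'$ in the second argument satisfying $$|\phi'(y,s)-\phi'(y,\tilde s)|\le L|s-\tilde s|^{\alpha}\qquad\text{for all } s,\tilde s\in\mathbb R,\ y\in\mathcal Y.$$ Write $\mathcal E(f)=\int_{\mathcal Z}\phi(y,f(x))\,d\rho(x,y)$. Assume that $\mathcal E$ has a minimizer $f_H$ over $H_K$ and that $\sup_{y\in\mathcal Y}\phi(y,0)<\infty$ and $\sup_{(x,y)\in\mathcal Z}\phi(y,f_H(x))<\infty$. Put $A=2\alpha^{\frac{1-\alpha}{1+\alpha}}L^{\frac{2}{1+\alpha}}(1+\alpha)$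 and let $0<\eta_1\le\frac1{A\kappa^2}$ (no upper bound if $\kappa=0$). For $\theta\in(\tfrac12,1)$ let $\eta_t=\eta_1t^{-\theta}$ and, for examples $z_t=(x_t,y_t)$, $t=1,2,\dots$, drawn independently from $\rho$, let $$f_1=0,\qquad f_{t+1}=f_t-\eta_t\,\phi'(y_t,f_t(x_t))K_{x_t},\quad t\ge1.$$ Then for every $\theta\in(\tfrac12,1)$ there is a constant $C>0$, independent of $T$, of $\delta$ and of the probability space on which the examples are defined, such that for all integers $T\ge2$ and all $\delta\in(0,1)$, with probability at least $1-\delta$, $$\mathcal E(f_{T+1})-\mathcal E(f_H)\le C\,T^{\max\{\theta-1,\;1-(1+\alpha)\theta\}}\log^2\frac T\delta .$$ In particular, for $\theta=\frac{2}{2+\alpha}$ there is such a constant $C>0$ such that for all $T\ge2$ and $\delta\in(0,1)$, with probability at least $1-\delta$, $$\mathcal E(f_{T+1})-\mathcal E(f_H)\le C\,T^{-\frac{\alpha}{2+\alpha}}\log^2\frac T\delta .$$ -/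

import Mathlib

open MeasureTheory ProbabilityTheory

noncomputable section

/-- A Mercer kernel: continuous, symmetric and positive semi-definite. -/
structure IsMercerKernel {X : Type*} [TopologicalSpace X] (K : X → X → ℝ) : Prop where
  continuous : Continuous (Function.uncurry K)
  symm : ∀ x x', K x x' = K x' x
  posSemidef : ∀ (n : ℕ) (x : Fin n → X) (c : Fin n → ℝ),
    0 ≤ ∑ i, ∑ j, c i * c j * K (x i) (x j)

/-- `H` is the reproducing kernel Hilbert space `H_K` of `K`: a Hilbert space of functions on `X`
whose reproducing kernel is `K` (it is determined by `K` up to a unique isometry that preserves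
the values of the functions). -/
def HasReproducingKernel {X : Type*} (H : Type*) [NormedAddCommGroup H] [InnerProductSpace ℝ H]
    [CompleteSpace H] [RKHS ℝ H X ℝ] (K : X → X → ℝ) : Prop :=
  ∀ x x', RKHS.kernel H x x' 1 = K x x'

/-- The function `K_x = K(x, ·)` as an element of `H_K`. -/
def kernelSection {X : Type*} (H : Type*) [NormedAddCommGroup H] [InnerProductSpace ℝ H]
    [CompleteSpace H] [RKHS ℝ H X ℝ] (x : X) : H :=
  RKHS.kerFun H x 1

/-- `κ = sup_x √(K(x, x))`. -/
def kernelBound {X : Type*} (K : X → X → ℝ) : ℝ :=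
  ⨆ x, √(K x x)

/-- A loss function `φ : Y × ℝ → ℝ₊`, convex and differentiable in the second argument, whose
derivative in the second argument is `(α, L)`-Hölder continuous, `α ∈ (0, 1]`, `L > 0`. -/
structure IsHolderLoss {Y : Type*} (φ : Y → ℝ → ℝ) (α L : ℝ) : Prop where
  alpha_pos : 0 < α
  alpha_le_one : α ≤ 1
  L_pos : 0 < L
  nonneg : ∀ y s, 0 ≤ φ y s
  convex : ∀ y, ConvexOn ℝ Set.univ (φ y)
  differentiable : ∀ y, Differentiable ℝ (φ y)
  holder : ∀ y s s', |deriv (φ y) s - deriv (φ y) s'| ≤ L * |s - s'| ^ α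

/-- The generalization error `ℰ(f) = ∫ φ(y, f(x)) dρ`. -/
def genError {X Y : Type*} [MeasurableSpace X] [MeasurableSpace Y] (ρ : Measure (X × Y))
    (φ : Y → ℝ → ℝ) (f : X → ℝ) : ℝ :=
  ∫ z, φ z.2 (f z.1) ∂ρ

/-- One step of online gradient descent with step size `s` at the example `z = (x, y)`:
`f ↦ f - s φ'(y, f(x)) K_x`. -/
def ogdStep {X Y H : Type*} [NormedAddCommGroup H] [InnerProductSpace ℝ H]
    [CompleteSpace H] [RKHS ℝ H X ℝ] (φ : Y → ℝ → ℝ) (s : ℝ) (z : X × Y) (f : H) : H :=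
  f - (s * deriv (φ z.2) (f z.1)) • kernelSection H z.1

/-- The iterates `f_t`, `t ≥ 1`, of online gradient descent: `f_1 = 0` and
`f_{t+1} = f_t - η_t φ'(y_t, f_t(x_t)) K_{x_t}` for `t ≥ 1`. The index `0` is not used. -/
def ogd {X Y : Type*} (H : Type*) [NormedAddCommGroup H] [InnerProductSpace ℝ H]
    [CompleteSpace H] [RKHS ℝ H X ℝ] (φ : Y → ℝ → ℝ) (η : ℕ → ℝ) (z : ℕ → X × Y) : ℕ → H
  | 0 => 0
  | 1 => 0
  | t + 2 => ogdStep φ (η (t + 1)) (z (t + 1)) (ogd H φ η z (t + 1))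

/-- The random examples `z_1, z_2, …` are drawn independently from `ρ`
(nothing is required of the unused `z_0`). -/
structure IsIIDSample {Ω Z : Type*} [MeasurableSpace Ω] [MeasurableSpace Z] (P : Measure Ω)
    (ρ : Measure Z) (z : ℕ → Ω → Z) : Prop where
  measurable : ∀ t, 1 ≤ t → Measurable (z t)
  indep : iIndepFun (fun t : ℕ => z (t + 1)) P
  law : ∀ t, 1 ≤ t → P.map (z t) = ρ

/-- The polynomially decaying step sizes `η_t = η₁ t^{-θ}`. -/
def polyStep (η₁ θ : ℝ) (t : ℕ) : ℝ :=
  η₁ * (t : ℝ) ^ (-θ)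

/-- The constant `A = 2 α^{(1-α)/(1+α)} L^{2/(1+α)} (1+α)`. -/
def constA (α L : ℝ) : ℝ :=
  2 * α ^ ((1 - α) / (1 + α)) * L ^ (2 / (1 + α)) * (1 + α)

end

/-! Write h for the minimizer, s_t for the steps, D_t = ‖f_t - h‖² and Δ_t for the excess error of
f_t. Convexity and the reproducing property give D_{t+1} ≤ D_t + 2 s_t (φ(y_t, h(x_t)) - φ(y_t,
f_t(x_t))) + s_t² κ² φ'². By the self-bounding property φ'² ≤ A φ + B and the cap on the first step,
multiplying this by s_t and telescoping bounds s_t D_t and Σ s_t² φ(y_t, f_t(x_t)) on every sample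
path. Hence D_n ≤ a + 2 Σ_{t<n} s_t (φ(y_t, h(x_t)) - φ(y_t, f_t(x_t))) with a constant a
(`norm_sq_le_add_sum`).

The summands of this last sum have conditional mean -s_t Δ_t. They are bounded, because s_t (1 +
D_t) is, and their conditional variance is at most a multiple of s_t² (1 + D_t) plus a part that
half of the drift absorbs. An exponential supermartingale, summability of s_t² and a self-bounding
induction (`add_sum_le_of_recursion`) then give D_n + Σ_{t<n} s_t Δ_t ≤ R for all n ≤ T with high
probability, where R is linear in log(T/δ).

To pass to the last iterate, the descent inequality gives Δ_{t+1} ≤ Δ_t - s_t φ' ∇ℰ(f_t)(x_t) + O((G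
s_t)^{1+α}), with G² of order 1 + R. The drift -s_t ‖∇ℰ(f_t)‖² of the middle term dominates its own
variance (`lintegral_exp_grad_le_one`), so its sums over [k, T) with k ≥ T/2 cost only a multiple of
s_{T/2} G² log(T/δ). Thus Δ_T exceeds each Δ_k, k in [T/2, T), by little, and the bound on Σ s_k Δ_k
controls their average (`last_le_of_recursion`). -/

/-! ### Convex losses with Hölder continuous derivative. -/

namespace IsHolderLoss

variable {Y : Type*} {φ : Y → ℝ → ℝ} {α L : ℝ}

/-- The tangent line inequality for a convex loss. -/
lemma add_deriv_mul_le (h : IsHolderLoss φ α L) (y : Y) (a b : ℝ) :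
    φ y a + deriv (φ y) a * (b - a) ≤ φ y b := by
  rcases lt_trichotomy a b with hab | rfl | hab
  · have := (h.convex y).deriv_le_slope (Set.mem_univ a) (Set.mem_univ b) hab (h.differentiable y a)
    rw [slope_def_field, le_div_iff₀ (sub_pos.2 hab)] at this
    linarith
  · simp
  · have := (h.convex y).slope_le_deriv (Set.mem_univ b) (Set.mem_univ a) hab (h.differentiable y a)
    rw [slope_def_field, div_le_iff₀ (sub_pos.2 hab)] at this
    linarith

/-- The descent inequality for a convex loss with Hölder continuous derivative. -/
lemma le_add_deriv_mul_add (h : IsHolderLoss φ α L) (y : Y) (a b : ℝ) :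
    φ y b ≤ φ y a + deriv (φ y) a * (b - a) + L * |b - a| ^ (1 + α) := by
  -- The tangent is taken at the endpoint `b`; convexity replaces integration of the derivative, at
  -- the price of the factor 1/(1+α).
  have h1 := h.add_deriv_mul_le y b a
  have h2 : (deriv (φ y) b - deriv (φ y) a) * (b - a) ≤ L * |b - a| ^ α * |b - a| :=
    (le_abs_self _).trans <| by
      rw [abs_mul]
      exact mul_le_mul_of_nonneg_right (h.holder y b a) (abs_nonneg _)
  have h3 : |b - a| ^ (1 + α) = |b - a| ^ α * |b - a| := by
    rw [add_comm, Real.rpow_add_one' (abs_nonneg _) (by linarith [h.alpha_pos])]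
  rw [h3]
  linarith

lemma constA_pos (h : IsHolderLoss φ α L) : 0 < constA α L := by
  have := h.alpha_pos
  have := h.L_pos
  unfold constA
  positivity

/-- Self-bounding property: the squared derivative is controlled by the loss, with the slope
`constA α L`. -/
lemma exists_deriv_sq_le (h : IsHolderLoss φ α L) :
    ∃ B : ℝ, 0 ≤ B ∧ ∀ y s, deriv (φ y) s ^ 2 ≤ constA α L * φ y s + B := by
  set A := constA α L with hA
  have hApos : 0 < A := h.constA_pos
  have hα := h.alpha_pos
  have hL := h.L_pos
  -- Nonnegativity of the loss at the test point `s - (2/A) φ'(s)`, inserted in the descent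
  -- inequality. For α = 1 the remainder is exactly φ'², as A = 4L. For α < 1 it is subquadratic in
  -- φ', so one square absorbs it up to a constant.
  have key : ∀ y s, 2 * deriv (φ y) s ^ 2
      ≤ A * φ y s + A * L * (2 / A * |deriv (φ y) s|) ^ (1 + α) := by
    intro y s
    set D := deriv (φ y) s with hD
    have h1 := h.le_add_deriv_mul_add y s (s - 2 / A * D)
    have h2 := h.nonneg y (s - 2 / A * D)
    rw [← hD, show s - 2 / A * D - s = -(2 / A * D) by ring, abs_neg, abs_mul,
      abs_of_pos (by positivity : 0 < 2 / A)] at h1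
    have h3 := mul_nonneg hApos.le (h2.trans h1)
    have h4 : A * (D * -(2 / A * D)) = -(2 * D ^ 2) := by field_simp
    nlinarith
  rcases h.alpha_le_one.eq_or_lt with h1 | h1
  · refine ⟨0, le_rfl, fun y s ↦ ?_⟩
    have := key y s
    have hA4 : A = 4 * L := by
      rw [hA, constA, h1]; norm_num; ring
    have e : A * L * (2 / A * |deriv (φ y) s|) ^ (1 + α) = deriv (φ y) s ^ 2 := by
      rw [h1, show (1 : ℝ) + 1 = 2 by norm_num, Real.rpow_two, mul_pow, sq_abs, hA4]
      field_simp
      ring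
    linarith
  · set k := A * L * (2 / A) ^ (1 + α) with hk
    have hkpos : 0 < k := by positivity
    -- The crossover point, where k r^(1+α) = r².
    set r := k ^ (1 / (1 - α)) with hr
    refine ⟨k * r ^ (1 + α), by positivity, fun y s ↦ ?_⟩
    have hks := key y s
    set D := |deriv (φ y) s| with hD
    have hD0 : 0 ≤ D := abs_nonneg _
    have e : A * L * (2 / A * D) ^ (1 + α) = k * D ^ (1 + α) := by
      rw [Real.mul_rpow (by positivity) hD0]; ring
    have e2 : deriv (φ y) s ^ 2 = D ^ 2 := (sq_abs _).symm
    rw [e, e2] at hks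
    rw [e2]
    suffices k * D ^ (1 + α) ≤ D ^ 2 + k * r ^ (1 + α) by linarith
    rcases le_total D r with hDr | hDr
    · have : D ^ (1 + α) ≤ r ^ (1 + α) := Real.rpow_le_rpow hD0 hDr (by linarith)
      nlinarith [sq_nonneg D]
    · have hkD : k ≤ D ^ (1 - α) := by
        have : r ^ (1 - α) ≤ D ^ (1 - α) :=
          Real.rpow_le_rpow (by positivity) hDr (by linarith)
        rwa [hr, ← Real.rpow_mul hkpos.le, one_div_mul_cancel (by linarith), Real.rpow_one] at this
      have hD2 : D ^ 2 = D ^ (1 - α) * D ^ (1 + α) := by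
        rw [← Real.rpow_add_of_nonneg hD0 (by linarith) (by linarith), ← Real.rpow_two]
        congr 1; ring
      have : 0 ≤ k * r ^ (1 + α) := by positivity
      have : k * D ^ (1 + α) ≤ D ^ (1 - α) * D ^ (1 + α) := by gcongr
      linarith

/-- If the loss is bounded at `0`, its derivative grows at most linearly. -/
lemma exists_abs_deriv_le (h : IsHolderLoss φ α L) (h0 : BddAbove (Set.range fun y ↦ φ y 0)) :
    ∃ M : ℝ, 1 ≤ M ∧ ∀ y s, |deriv (φ y) s| ≤ M * (1 + |s|) := by
  obtain ⟨B, hB, hder⟩ := h.exists_deriv_sq_le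
  obtain ⟨b, hb⟩ := h0
  have hL := h.L_pos
  have hApos := h.constA_pos
  have hc : 0 ≤ constA α L * |b| + B := by positivity
  refine ⟨1 + (constA α L * |b| + B) + L, by linarith, fun y s ↦ ?_⟩
  have h1 : |deriv (φ y) 0| ≤ 1 + (constA α L * |b| + B) := by
    have h2 := hder y 0
    have h3 : φ y 0 ≤ |b| := (hb ⟨y, rfl⟩).trans (le_abs_self b)
    have h4 : constA α L * φ y 0 ≤ constA α L * |b| := by gcongr
    rw [← sq_abs] at h2
    nlinarith [sq_nonneg (|deriv (φ y) 0| - 1)]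
  have h2 := h.holder y s 0
  rw [sub_zero] at h2
  have h3 : |s| ^ α ≤ 1 + |s| := by
    rcases le_total |s| 1 with hs | hs
    · have := Real.rpow_le_one (abs_nonneg s) hs h.alpha_pos.le
      linarith [abs_nonneg s]
    · have := Real.rpow_le_rpow_of_exponent_le hs h.alpha_le_one
      rw [Real.rpow_one] at this
      linarith
  have h4 : |deriv (φ y) s| ≤ |deriv (φ y) 0| + |deriv (φ y) s - deriv (φ y) 0| := by
    have := abs_add_le (deriv (φ y) 0) (deriv (φ y) s - deriv (φ y) 0)
    simpa using this
  have h5 : L * |s| ^ α ≤ L * (1 + |s|) := by gcongr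
  nlinarith [abs_nonneg s, mul_nonneg hc (abs_nonneg s)]

/-- A loss whose derivative grows linearly is locally Lipschitz. -/
lemma abs_sub_le (h : IsHolderLoss φ α L) {M : ℝ}
    (hM : ∀ y s, |deriv (φ y) s| ≤ M * (1 + |s|)) (y : Y) (a b : ℝ) :
    |φ y a - φ y b| ≤ M * (1 + |a| + |b|) * |a - b| := by
  have h1 := h.add_deriv_mul_le y a b
  have h2 := h.add_deriv_mul_le y b a
  have hM0 : 0 ≤ M := by simpa using (abs_nonneg _).trans (hM y 0)
  have e1 : deriv (φ y) a * (a - b) ≤ M * (1 + |a| + |b|) * |a - b| :=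
    (le_abs_self _).trans <| by
      rw [abs_mul]
      refine mul_le_mul_of_nonneg_right ((hM y a).trans ?_) (abs_nonneg _)
      exact mul_le_mul_of_nonneg_left (by linarith [abs_nonneg b]) hM0
  have e2 : -(deriv (φ y) b * (a - b)) ≤ M * (1 + |a| + |b|) * |a - b| :=
    (neg_le_abs _).trans <| by
      rw [abs_mul]
      refine mul_le_mul_of_nonneg_right ((hM y b).trans ?_) (abs_nonneg _)
      exact mul_le_mul_of_nonneg_left (by linarith [abs_nonneg a]) hM0
  rw [abs_le]
  constructor <;> linarith

/-- Joint measurability of the derivative of a measurable loss. -/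
lemma measurable_deriv [MeasurableSpace Y] (h : IsHolderLoss φ α L)
    (hm : Measurable (Function.uncurry φ)) :
    Measurable (fun p : Y × ℝ ↦ deriv (φ p.1) p.2) := by
  have hu : Filter.Tendsto (fun n : ℕ ↦ (1 : ℝ) / ((n : ℝ) + 1)) Filter.atTop
      (nhdsWithin 0 {0}ᶜ) :=
    tendsto_nhdsWithin_iff.2 ⟨tendsto_one_div_add_atTop_nhds_zero_nat,
      Filter.Eventually.of_forall fun n ↦ by
        simp only [Set.mem_compl_iff, Set.mem_singleton_iff]; positivity⟩
  refine measurable_of_tendsto_metrizable (f := fun (n : ℕ) (p : Y × ℝ) ↦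
    ((1 : ℝ) / ((n : ℝ) + 1))⁻¹ * (φ p.1 (p.2 + 1 / ((n : ℝ) + 1)) - φ p.1 p.2)) (fun n ↦ ?_) ?_
  · exact ((hm.comp (measurable_fst.prodMk (measurable_snd.add_const _))).sub hm).const_mul _
  · rw [tendsto_pi_nhds]
    intro p
    have := (hasDerivAt_iff_tendsto_slope_zero.1 (h.differentiable p.1 p.2).hasDerivAt)
    exact this.comp hu

end IsHolderLoss

/-! ### Exponential supermartingales for i.i.d. samples. -/

section ExponentialSupermartingale

open scoped ENNReal

variable {Z Ω : Type*} [MeasurableSpace Z] [MeasurableSpace Ω] {ρ : Measure Z}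
  [IsProbabilityMeasure ρ] {P : Measure Ω} [IsProbabilityMeasure P] {w : ℕ → Ω → Z}

/-- For an i.i.d. sequence, a function of the past and of the present can be integrated over
the present first. -/
lemma lintegral_past_present (hw : ∀ n, Measurable (w n)) (hind : iIndepFun w P)
    (hlaw : ∀ n, P.map (w n) = ρ) (n : ℕ) {F : (ℕ → Z) → Z → ℝ≥0∞}
    (hF : Measurable (Function.uncurry F))
    (hdep : ∀ v v' : ℕ → Z, (∀ i < n, v i = v' i) → F v = F v') :
    ∫⁻ ω, F (fun i ↦ w i ω) (w n ω) ∂P = ∫⁻ ω, ∫⁻ x, F (fun i ↦ w i ω) x ∂ρ ∂P := by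
  obtain ⟨z0⟩ : Nonempty Z := nonempty_of_isProbabilityMeasure ρ
  -- A finite past is padded with `z0`; by `hdep`, `F` does not see the padding.
  set e : (Finset.range n → Z) → ℕ → Z :=
    fun h i ↦ if hi : i ∈ Finset.range n then h ⟨i, hi⟩ else z0 with he
  have hem : Measurable e := by
    refine measurable_pi_lambda _ fun i ↦ ?_
    by_cases hi : i ∈ Finset.range n
    · simp only [he, hi, dite_true]
      exact measurable_pi_apply _
    · simp only [he, hi, dite_false]
      exact measurable_const
  set past : Ω → (Finset.range n → Z) := fun ω i ↦ w i ω with hpast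
  have hpm : Measurable past := measurable_pi_lambda _ fun i ↦ hw i
  have hFe : ∀ ω, F (fun i ↦ w i ω) = F (e (past ω)) := fun ω ↦
    hdep _ _ fun i hi ↦ by simp [he, hpast, hi]
  have hI : IndepFun past (w n) P :=
    (hind.indepFun_finset (Finset.range n) {n} (by simp) hw).comp measurable_id
      (measurable_pi_apply (⟨n, by simp⟩ : ({n} : Finset ℕ)))
  have hmap := hI.map_prod_eq_prod_map_map hpm.aemeasurable (hw n).aemeasurable
  have hG : Measurable (fun p : (Finset.range n → Z) × Z ↦ F (e p.1) p.2) :=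
    hF.comp ((hem.comp measurable_fst).prodMk measurable_snd)
  simp_rw [hFe]
  have : IsProbabilityMeasure (P.map past) := Measure.isProbabilityMeasure_map hpm.aemeasurable
  calc ∫⁻ ω, F (e (past ω)) (w n ω) ∂P
      = ∫⁻ p, F (e p.1) p.2 ∂(P.map fun ω ↦ (past ω, w n ω)) :=
        (lintegral_map hG (hpm.prodMk (hw n))).symm
    _ = ∫⁻ h, ∫⁻ x, F (e h) x ∂ρ ∂(P.map past) := by
        rw [hmap, hlaw, lintegral_prod _ hG.aemeasurable]
    _ = _ := lintegral_map hG.lintegral_prod_right' hpm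

/-- Exponential supermartingale: if the conditional exponential moments of the increments are at
most one, so is the exponential moment of their sum. -/
lemma lintegral_exp_sum_le_one (hw : ∀ n, Measurable (w n)) (hind : iIndepFun w P)
    (hlaw : ∀ n, P.map (w n) = ρ) {u : ℕ → (ℕ → Z) → Z → ℝ}
    (hu : ∀ t, Measurable (Function.uncurry (u t)))
    (hdep : ∀ t, ∀ v v' : ℕ → Z, (∀ i < t, v i = v' i) → u t v = u t v')
    (hexp : ∀ t v, ∫⁻ x, ENNReal.ofReal (Real.exp (u t v x)) ∂ρ ≤ 1) (n : ℕ) :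
    ∫⁻ ω, ENNReal.ofReal (Real.exp (∑ t ∈ Finset.range n, u t (fun i ↦ w i ω) (w t ω))) ∂P
      ≤ 1 := by
  induction n with
  | zero => simp
  | succ n ih =>
    set S : (ℕ → Z) → ℝ := fun v ↦ ∑ t ∈ Finset.range n, u t v (v t) with hS
    have hSm : Measurable S := Finset.measurable_sum _ fun t _ ↦
      (hu t).comp (measurable_id.prodMk (measurable_pi_apply t))
    have hSdep : ∀ v v' : ℕ → Z, (∀ i < n, v i = v' i) → S v = S v' := fun v v' h ↦
      Finset.sum_congr rfl fun t ht ↦ by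
        rw [Finset.mem_range] at ht
        rw [hdep t v v' fun i hi ↦ h i (hi.trans ht), h t ht]
    set F : (ℕ → Z) → Z → ℝ≥0∞ := fun v x ↦
      ENNReal.ofReal (Real.exp (S v)) * ENNReal.ofReal (Real.exp (u n v x)) with hF
    have hE : Measurable fun x ↦ ENNReal.ofReal (Real.exp x) :=
      ENNReal.measurable_ofReal.comp Real.measurable_exp
    have hFm : Measurable (Function.uncurry F) :=
      ((hE.comp hSm).comp measurable_fst).mul (hE.comp (hu n))
    have key := lintegral_past_present hw hind hlaw n hFm fun v v' h ↦ by
      simp only [hF, hSdep v v' h, hdep n v v' h]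
    calc _ = ∫⁻ ω, F (fun i ↦ w i ω) (w n ω) ∂P := by
          refine lintegral_congr fun ω ↦ ?_
          simp only [hF, hS]
          rw [Finset.sum_range_succ, Real.exp_add, ENNReal.ofReal_mul (Real.exp_pos _).le]
      _ = ∫⁻ ω, ∫⁻ x, F (fun i ↦ w i ω) x ∂ρ ∂P := key
      _ ≤ ∫⁻ ω, ENNReal.ofReal (Real.exp (S fun i ↦ w i ω)) ∂P := by
          refine lintegral_mono fun ω ↦ ?_
          simp only [hF]
          rw [lintegral_const_mul' _ _ ENNReal.ofReal_ne_top]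
          exact mul_le_of_le_one_right' (hexp n _)
      _ ≤ 1 := ih

/-- Chernoff bound for sums with conditional exponential moments at most one. -/
lemma measureReal_lt_sum_le (hw : ∀ n, Measurable (w n)) (hind : iIndepFun w P)
    (hlaw : ∀ n, P.map (w n) = ρ) {u : ℕ → (ℕ → Z) → Z → ℝ}
    (hu : ∀ t, Measurable (Function.uncurry (u t)))
    (hdep : ∀ t, ∀ v v' : ℕ → Z, (∀ i < t, v i = v' i) → u t v = u t v')
    (hexp : ∀ t v, ∫⁻ x, ENNReal.ofReal (Real.exp (u t v x)) ∂ρ ≤ 1) (n : ℕ) (l : ℝ) :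
    P.real {ω | l < ∑ t ∈ Finset.range n, u t (fun i ↦ w i ω) (w t ω)} ≤ Real.exp (-l) := by
  set S : Ω → ℝ := fun ω ↦ ∑ t ∈ Finset.range n, u t (fun i ↦ w i ω) (w t ω) with hS
  have hSm : Measurable S := Finset.measurable_sum _ fun t _ ↦
    (hu t).comp ((measurable_pi_lambda _ hw).prodMk (hw t))
  have hf : Measurable fun ω ↦ ENNReal.ofReal (Real.exp (S ω)) :=
    ENNReal.measurable_ofReal.comp (Real.measurable_exp.comp hSm)
  have h1 := mul_meas_ge_le_lintegral (μ := P) hf (ENNReal.ofReal (Real.exp l))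
  have h2 := h1.trans (lintegral_exp_sum_le_one hw hind hlaw hu hdep hexp n)
  have h3 : P {ω | l < S ω} ≤ ENNReal.ofReal (Real.exp (-l)) := by
    calc P {ω | l < S ω}
        ≤ P {ω | ENNReal.ofReal (Real.exp l) ≤ ENNReal.ofReal (Real.exp (S ω))} :=
          measure_mono fun ω hω ↦ ENNReal.ofReal_le_ofReal (Real.exp_le_exp.2 (le_of_lt hω))
      _ = ENNReal.ofReal (Real.exp (-l)) * (ENNReal.ofReal (Real.exp l) *
            P {ω | ENNReal.ofReal (Real.exp l) ≤ ENNReal.ofReal (Real.exp (S ω))}) := by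
          rw [← mul_assoc, ← ENNReal.ofReal_mul (Real.exp_pos _).le, ← Real.exp_add]
          simp
      _ ≤ ENNReal.ofReal (Real.exp (-l)) * 1 := by gcongr
      _ = _ := mul_one _
  exact ENNReal.toReal_le_of_le_ofReal (Real.exp_pos _).le h3

end ExponentialSupermartingale

/-- A second order bound for the exponential moment of a variable bounded by one. -/
lemma lintegral_exp_sub_le_one {Z : Type*} [MeasurableSpace Z] {ρ : Measure Z}
    [IsProbabilityMeasure ρ] {X : Z → ℝ} (hX : AEStronglyMeasurable X ρ) (h1 : ∀ x, |X x| ≤ 1)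
    {c : ℝ} (hc : ∫ x, X x ∂ρ + ∫ x, X x ^ 2 ∂ρ ≤ c) :
    ∫⁻ x, ENNReal.ofReal (Real.exp (X x - c)) ∂ρ ≤ 1 := by
  have hXi : Integrable X ρ :=
    Integrable.of_bound hX 1 (Filter.Eventually.of_forall fun x ↦ by simpa using h1 x)
  have hX2 : Integrable (fun x ↦ X x ^ 2) ρ :=
    Integrable.of_bound (hX.pow 2) 1 (Filter.Eventually.of_forall fun x ↦ by
      rw [norm_pow, Real.norm_eq_abs]
      exact pow_le_one₀ (abs_nonneg _) (h1 x))
  have hq : Integrable (fun x ↦ Real.exp (-c) * (1 + X x + X x ^ 2)) ρ :=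
    (((integrable_const 1).add hXi).add hX2).const_mul _
  have hle : ∀ x, Real.exp (X x - c) ≤ Real.exp (-c) * (1 + X x + X x ^ 2) := fun x ↦ by
    rw [sub_eq_add_neg, add_comm, Real.exp_add]
    -- This gives e^x ≤ 1 + x + x² for |x| ≤ 1; after integration, 1 + u ≤ e^u closes the estimate.
    have := (le_abs_self _).trans (Real.abs_exp_sub_one_sub_id_le (h1 x))
    exact mul_le_mul_of_nonneg_left (by linarith) (Real.exp_pos _).le
  calc ∫⁻ x, ENNReal.ofReal (Real.exp (X x - c)) ∂ρ
      ≤ ∫⁻ x, ENNReal.ofReal (Real.exp (-c) * (1 + X x + X x ^ 2)) ∂ρ :=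
        lintegral_mono fun x ↦ ENNReal.ofReal_le_ofReal (hle x)
    _ = ENNReal.ofReal (∫ x, Real.exp (-c) * (1 + X x + X x ^ 2) ∂ρ) :=
        (ofReal_integral_eq_lintegral_ofReal hq
          (Filter.Eventually.of_forall fun x ↦ (Real.exp_pos _).le.trans (hle x))).symm
    _ ≤ 1 := by
        have e : ∫ x, 1 + X x + X x ^ 2 ∂ρ = 1 + ∫ x, X x ∂ρ + ∫ x, X x ^ 2 ∂ρ := by
          rw [integral_add (f := fun x ↦ 1 + X x) ((integrable_const 1).add hXi) hX2,
            integral_add (integrable_const 1) hXi]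
          simp
        rw [ENNReal.ofReal_le_one, integral_const_mul, e]
        have h2 : ∫ x, X x ∂ρ + ∫ x, X x ^ 2 ∂ρ + 1 ≤ Real.exp c :=
          (add_le_add_left hc 1).trans (Real.add_one_le_exp c)
        calc Real.exp (-c) * (1 + ∫ x, X x ∂ρ + ∫ x, X x ^ 2 ∂ρ)
            ≤ Real.exp (-c) * Real.exp c := by
              refine mul_le_mul_of_nonneg_left ?_ (Real.exp_pos _).le
              linarith
          _ = 1 := by rw [← Real.exp_add]; simp

/-! ### Kernel sections and point evaluations. -/

section KernelSection

open scoped InnerProductSpace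

variable {X H : Type*} [NormedAddCommGroup H] [InnerProductSpace ℝ H] [CompleteSpace H]
  [RKHS ℝ H X ℝ]

lemma inner_kernelSection (f : H) (x : X) : ⟪f, kernelSection H x⟫_ℝ = f x := by
  rw [kernelSection, RKHS.inner_kerFun]
  simp

lemma HasReproducingKernel.inner_kernelSection {K : X → X → ℝ} (h : HasReproducingKernel H K)
    (x x' : X) : ⟪kernelSection H x, kernelSection H x'⟫_ℝ = K x' x := by
  rw [_root_.inner_kernelSection, kernelSection, RKHS.kerFun_apply, h]

lemma HasReproducingKernel.norm_kernelSection {K : X → X → ℝ} (h : HasReproducingKernel H K)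
    (x : X) : ‖kernelSection H x‖ = √(K x x) := by
  rw [← h.inner_kernelSection, real_inner_self_eq_norm_sq, Real.sqrt_sq (norm_nonneg _)]

lemma HasReproducingKernel.continuous_kernelSection [TopologicalSpace X] {K : X → X → ℝ}
    (h : HasReproducingKernel H K) (hK : Continuous (Function.uncurry K)) :
    Continuous (kernelSection H : X → H) := by
  rw [continuous_iff_continuousAt]
  intro x
  rw [ContinuousAt, tendsto_iff_norm_sub_tendsto_zero]
  have e : ∀ x', ‖kernelSection H x' - kernelSection H x‖ = √(K x' x' - 2 * K x x' + K x x) := by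
    intro x'
    rw [← Real.sqrt_sq (norm_nonneg (kernelSection H x' - kernelSection H x)),
      norm_sub_sq_real, h.inner_kernelSection, ← real_inner_self_eq_norm_sq,
      ← real_inner_self_eq_norm_sq, h.inner_kernelSection, h.inner_kernelSection]
  simp_rw [e]
  have hc : Continuous fun x' ↦ √(K x' x' - 2 * K x x' + K x x) := by
    have h1 : Continuous fun x' ↦ K x' x' := hK.comp (continuous_id.prodMk continuous_id)
    have h2 : Continuous fun x' ↦ K x x' := hK.comp (continuous_const.prodMk continuous_id)
    fun_prop
  have := hc.tendsto x
  simp only [show K x x - 2 * K x x + K x x = 0 by ring, Real.sqrt_zero] at this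
  exact this

lemma RKHS.abs_apply_le {κ : ℝ} (hκ : ∀ x, ‖kernelSection H x‖ ≤ κ) (f : H) (x : X) :
    |f x| ≤ κ * ‖f‖ := by
  rw [← inner_kernelSection]
  refine (abs_real_inner_le_norm _ _).trans ?_
  rw [mul_comm]
  exact mul_le_mul_of_nonneg_right (hκ x) (norm_nonneg f)

end KernelSection

/-! ### Bounds on the iterates along every sample path. -/

section Iterates

variable {X Y H : Type*} [NormedAddCommGroup H] [InnerProductSpace ℝ H] [CompleteSpace H]
  [RKHS ℝ H X ℝ] {φ : Y → ℝ → ℝ} {α L : ℝ}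

/-- Online gradient descent indexed from `0`: the iterate after `n` steps, as a function of the
sequence of examples. -/
noncomputable def ogdIter (H : Type*) [NormedAddCommGroup H] [InnerProductSpace ℝ H]
    [CompleteSpace H] [RKHS ℝ H X ℝ] (φ : Y → ℝ → ℝ) (s : ℕ → ℝ) (v : ℕ → X × Y) : ℕ → H
  | 0 => 0
  | n + 1 => ogdStep φ (s n) (v n) (ogdIter H φ s v n)

lemma ogd_succ_eq_ogdIter (η : ℕ → ℝ) (z : ℕ → X × Y) (n : ℕ) :
    ogd H φ η z (n + 1) = ogdIter H φ (fun n ↦ η (n + 1)) (fun n ↦ z (n + 1)) n := by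
  induction n with
  | zero => rfl
  | succ n ih => rw [ogd, ih, ogdIter]

lemma ogdIter_congr (s : ℕ → ℝ) {v v' : ℕ → X × Y} (n : ℕ) (h : ∀ i < n, v i = v' i) :
    ogdIter H φ s v n = ogdIter H φ s v' n := by
  induction n with
  | zero => rfl
  | succ n ih =>
    rw [ogdIter, ogdIter, ih fun i hi ↦ h i (hi.trans n.lt_succ_self), h n n.lt_succ_self]

/-- Expand the square: the cross term is evaluation of f - h at x by the reproducing property, and
the tangent line inequality turns it into a difference of losses. -/
lemma norm_ogdStep_sub_sq_le (hφ : IsHolderLoss φ α L) {κ : ℝ}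
    (hκ : ∀ x, ‖kernelSection H x‖ ≤ κ) {s : ℝ} (hs : 0 ≤ s) (z : X × Y) (f h : H) :
    ‖ogdStep φ s z f - h‖ ^ 2 ≤ ‖f - h‖ ^ 2 + 2 * (s * (φ z.2 (h z.1) - φ z.2 (f z.1)))
      + s ^ 2 * κ ^ 2 * deriv (φ z.2) (f z.1) ^ 2 := by
  set D := deriv (φ z.2) (f z.1) with hD
  have e : ogdStep φ s z f - h = (f - h) - (s * D) • kernelSection H z.1 := by
    rw [ogdStep]; abel
  have h1 := hφ.add_deriv_mul_le z.2 (f z.1) (h z.1)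
  rw [← hD] at h1
  rw [e, norm_sub_sq_real, real_inner_smul_right, inner_kernelSection, norm_smul, mul_pow,
    Real.norm_eq_abs, sq_abs]
  have h2 : ‖kernelSection H z.1‖ ^ 2 ≤ κ ^ 2 := by gcongr; exact hκ _
  have h3 : (s * D) ^ 2 * ‖kernelSection H z.1‖ ^ 2 ≤ (s * D) ^ 2 * κ ^ 2 := by gcongr
  have h4 : s * (φ z.2 (f z.1) + D * (h z.1 - f z.1)) ≤ s * φ z.2 (h z.1) := by gcongr
  have h5 : (f - h) z.1 = f z.1 - h z.1 := by simp
  rw [h5]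
  nlinarith

section Deterministic

variable (hφ : IsHolderLoss φ α L) {κ A B b S : ℝ} (hκ : ∀ x, ‖kernelSection H x‖ ≤ κ)
  (hB : 0 ≤ B) (hderiv : ∀ y t, deriv (φ y) t ^ 2 ≤ A * φ y t + B)
  {s : ℕ → ℝ} (hs : ∀ n, 0 ≤ s n) (hanti : Antitone s) (hsA : s 0 * (A * κ ^ 2) ≤ 1)
  (hA : 0 ≤ A) {h : H} (hb : ∀ z : X × Y, φ z.2 (h z.1) ≤ b)
  (hS : ∀ n, ∑ t ∈ Finset.range n, s t ^ 2 ≤ S)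
  (v : ℕ → X × Y) (n : ℕ)

include hφ hκ hB hderiv hs hanti hsA hA hb hS

/-- The one-step inequality multiplied by `s n` telescopes, since the steps decrease. No probability
enters, so the increments treated later are bounded surely. -/
lemma sum_sq_mul_loss_add_le [Nonempty (X × Y)] :
    ∑ t ∈ Finset.range n, s t ^ 2 * φ (v t).2 (ogdIter H φ s v t (v t).1)
        + s n * ‖ogdIter H φ s v n - h‖ ^ 2
      ≤ s 0 * ‖h‖ ^ 2 + (2 * b + s 0 * κ ^ 2 * B) * S := by
  have hb0 : 0 ≤ b := (hφ.nonneg _ _).trans (hb (Classical.arbitrary _))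
  have hs0 := hs 0
  -- The induction needs the partial sum of squares in place of its bound `S`.
  refine le_trans ?_ (add_le_add_right (mul_le_mul_of_nonneg_left (hS n) (by positivity)) _)
  induction n with
  | zero => simp [ogdIter]
  | succ n ih =>
    rw [Finset.sum_range_succ, Finset.sum_range_succ]
    set f := ogdIter H φ s v n
    set p := φ (v n).2 (f (v n).1) with hp
    have hp0 : 0 ≤ p := hφ.nonneg _ _
    have hsn := hs n
    have hn0 : s n ≤ s 0 := hanti (Nat.zero_le n)
    have h1 := norm_ogdStep_sub_sq_le hφ hκ hsn (v n) f h
    rw [← hp] at h1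
    have h2 : s n ^ 2 * κ ^ 2 * deriv (φ (v n).2) (f (v n).1) ^ 2
        ≤ s n ^ 2 * κ ^ 2 * (A * p + B) := by gcongr; exact hderiv _ _
    -- The step size cap: the squared gradient uses up one of the two copies of `s n * p` gained by
    -- convexity, and the other one remains.
    have h3 : s n * (s n * (A * κ ^ 2)) * p ≤ s n * 1 * p := by
      gcongr
      exact (mul_le_mul_of_nonneg_right hn0 (by positivity)).trans hsA
    have h4 : s n * (s n * κ ^ 2 * B) ≤ s n * (s 0 * κ ^ 2 * B) := by gcongr
    have h5 : s n * φ (v n).2 (h (v n).1) ≤ s n * b := by gcongr; exact hb _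
    have h6 : ‖ogdStep φ (s n) (v n) f - h‖ ^ 2
        ≤ ‖f - h‖ ^ 2 + s n * (2 * b + s 0 * κ ^ 2 * B) - s n * p := by linarith
    have h7 : s (n + 1) * ‖ogdStep φ (s n) (v n) f - h‖ ^ 2
        ≤ s n * ‖ogdStep φ (s n) (v n) f - h‖ ^ 2 := by
      gcongr; exact hanti n.le_succ
    have h8 := mul_le_mul_of_nonneg_left h6 hsn
    have h9 : ogdIter H φ s v (n + 1) = ogdStep φ (s n) (v n) f := rfl
    rw [h9]
    linarith

/-- The deterministic growth bound of the iterates. -/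
lemma step_mul_norm_sq_le [Nonempty (X × Y)] :
    s n * ‖ogdIter H φ s v n - h‖ ^ 2
      ≤ s 0 * ‖h‖ ^ 2 + (2 * b + s 0 * κ ^ 2 * B) * S := by
  refine le_trans ?_ (sum_sq_mul_loss_add_le hφ hκ hB hderiv hs hanti hsA hA hb hS v n)
  refine le_add_of_nonneg_left (Finset.sum_nonneg fun t _ ↦ ?_)
  exact mul_nonneg (sq_nonneg _) (hφ.nonneg _ _)

/-- The same telescoping without weights: the squared gradients now have a bounded sum by
`sum_sq_mul_loss_add_le`, so only the loss differences are left to the probabilistic argument. -/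
lemma norm_sq_le_add_sum [Nonempty (X × Y)] :
    ‖ogdIter H φ s v n - h‖ ^ 2 ≤ ‖h‖ ^ 2
      + κ ^ 2 * (A * (s 0 * ‖h‖ ^ 2 + (2 * b + s 0 * κ ^ 2 * B) * S) + B * S)
      + 2 * ∑ t ∈ Finset.range n, s t * (φ (v t).2 (h (v t).1)
        - φ (v t).2 (ogdIter H φ s v t (v t).1)) := by
  have h0 : ∑ t ∈ Finset.range n, s t ^ 2 * φ (v t).2 (ogdIter H φ s v t (v t).1)
      ≤ s 0 * ‖h‖ ^ 2 + (2 * b + s 0 * κ ^ 2 * B) * S :=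
    (le_add_of_nonneg_right (mul_nonneg (hs n) (sq_nonneg _))).trans
      (sum_sq_mul_loss_add_le hφ hκ hB hderiv hs hanti hsA hA hb hS v n)
  have h1 : ‖ogdIter H φ s v n - h‖ ^ 2 ≤ ‖h‖ ^ 2
      + κ ^ 2 * (A * ∑ t ∈ Finset.range n, s t ^ 2 * φ (v t).2 (ogdIter H φ s v t (v t).1)
        + B * ∑ t ∈ Finset.range n, s t ^ 2)
      + 2 * ∑ t ∈ Finset.range n, s t * (φ (v t).2 (h (v t).1)
        - φ (v t).2 (ogdIter H φ s v t (v t).1)) := by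
    clear h0
    induction n with
    | zero => simp [ogdIter]
    | succ n ih =>
      simp_rw [Finset.sum_range_succ]
      set f := ogdIter H φ s v n
      have h1 := norm_ogdStep_sub_sq_le hφ hκ (hs n) (v n) f h
      have h2 : s n ^ 2 * κ ^ 2 * deriv (φ (v n).2) (f (v n).1) ^ 2
          ≤ s n ^ 2 * κ ^ 2 * (A * φ (v n).2 (f (v n).1) + B) := by gcongr; exact hderiv _ _
      have h9 : ogdIter H φ s v (n + 1) = ogdStep φ (s n) (v n) f := rfl
      rw [h9]
      linarith
  refine h1.trans ?_
  gcongr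
  exact hS n

end Deterministic

end Iterates

/-! ### The generalization error, its gradient, and conditional exponential moments. -/

section GeneralizationError

open scoped InnerProductSpace

variable {X Y H : Type*} [TopologicalSpace X] [SecondCountableTopology X] [MeasurableSpace X]
  [OpensMeasurableSpace X] [MeasurableSpace Y]
  [NormedAddCommGroup H] [InnerProductSpace ℝ H] [CompleteSpace H] [RKHS ℝ H X ℝ]
  {φ : Y → ℝ → ℝ} {α L : ℝ}

/-- The gradient in `H_K` of the generalization error. -/
noncomputable def genGrad (ρ : Measure (X × Y)) (φ : Y → ℝ → ℝ) (f : H) : H :=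
  ∫ z, deriv (φ z.2) (f z.1) • kernelSection H z.1 ∂ρ

section Measurability

variable {V : Type*} [MeasurableSpace V] (hk : Continuous (kernelSection H : X → H))

include hk

/-- Evaluation is the inner product with a continuous kernel section. Strong measurability is used
because `H` is not assumed separable; `V` is the path space, or `Unit` for a fixed function. -/
lemma measurable_eval {F : V → H} (hF : StronglyMeasurable F) :
    Measurable fun p : V × (X × Y) ↦ F p.1 p.2.1 := by
  have h1 : StronglyMeasurable fun p : V × (X × Y) ↦ F p.1 := hF.comp_measurable measurable_fst
  have h2 : StronglyMeasurable fun p : V × (X × Y) ↦ kernelSection H p.2.1 :=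
    hk.stronglyMeasurable.comp_measurable (measurable_fst.comp measurable_snd)
  have := (h1.inner (𝕜 := ℝ) h2).measurable
  simpa only [inner_kernelSection] using this

lemma measurable_loss_eval (hφm : Measurable (Function.uncurry φ)) {F : V → H}
    (hF : StronglyMeasurable F) :
    Measurable fun p : V × (X × Y) ↦ φ p.2.2 (F p.1 p.2.1) :=
  hφm.comp ((measurable_snd.comp measurable_snd).prodMk (measurable_eval hk hF))

lemma measurable_deriv_eval (hφ : IsHolderLoss φ α L) (hφm : Measurable (Function.uncurry φ))
    {F : V → H} (hF : StronglyMeasurable F) :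
    Measurable fun p : V × (X × Y) ↦ deriv (φ p.2.2) (F p.1 p.2.1) :=
  (hφ.measurable_deriv hφm).comp
    ((measurable_snd.comp measurable_snd).prodMk (measurable_eval hk hF))

lemma measurable_genError (ρ : Measure (X × Y)) [SFinite ρ]
    (hφm : Measurable (Function.uncurry φ)) {F : V → H} (hF : StronglyMeasurable F) :
    Measurable fun p : V ↦ genError ρ φ (F p) :=
  (measurable_loss_eval hk hφm hF).stronglyMeasurable.integral_prod_right'.measurable

lemma stronglyMeasurable_genGrad (ρ : Measure (X × Y)) [SFinite ρ] (hφ : IsHolderLoss φ α L)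
    (hφm : Measurable (Function.uncurry φ)) {F : V → H} (hF : StronglyMeasurable F) :
    StronglyMeasurable fun p : V ↦ genGrad ρ φ (F p) := by
  have h2 : StronglyMeasurable fun p : V × (X × Y) ↦ kernelSection H p.2.1 :=
    hk.stronglyMeasurable.comp_measurable (measurable_fst.comp measurable_snd)
  exact ((measurable_deriv_eval hk hφ hφm hF).stronglyMeasurable.smul h2).integral_prod_right'

lemma stronglyMeasurable_ogdIter (hφ : IsHolderLoss φ α L) (hφm : Measurable (Function.uncurry φ))
    (s : ℕ → ℝ) (n : ℕ) : StronglyMeasurable fun v : ℕ → X × Y ↦ ogdIter H φ s v n := by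
  induction n with
  | zero => exact stronglyMeasurable_const
  | succ n ih =>
    have h1 : Measurable fun v : ℕ → X × Y ↦ (v, v n) :=
      measurable_id.prodMk (measurable_pi_apply n)
    have h2 := (measurable_deriv_eval hk hφ hφm ih).comp h1
    have h3 : StronglyMeasurable fun v : ℕ → X × Y ↦ kernelSection H (v n).1 :=
      hk.stronglyMeasurable.comp_measurable (measurable_fst.comp (measurable_pi_apply n))
    exact ih.sub ((h2.const_mul (s n)).stronglyMeasurable.smul h3)

end Measurability

variable {ρ : Measure (X × Y)} [IsProbabilityMeasure ρ]
  (hk : Continuous (kernelSection H : X → H)) (hφ : IsHolderLoss φ α L)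
  (hφm : Measurable (Function.uncurry φ)) {κ M : ℝ} (hκ : ∀ x, ‖kernelSection H x‖ ≤ κ)
  (hM : ∀ y t, |deriv (φ y) t| ≤ M * (1 + |t|))

include hk hφ hφm hκ hM

omit [SecondCountableTopology X] [OpensMeasurableSpace X] [TopologicalSpace X]
  [IsProbabilityMeasure ρ] [MeasurableSpace X] [MeasurableSpace Y] hk hφ hφm in
lemma abs_deriv_eval_le (f : H) (z : X × Y) :
    |deriv (φ z.2) (f z.1)| ≤ M * (1 + κ * ‖f‖) := by
  have hM0 : 0 ≤ M := by simpa using (abs_nonneg _).trans (hM z.2 0)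
  refine (hM _ _).trans (mul_le_mul_of_nonneg_left ?_ hM0)
  linarith [RKHS.abs_apply_le hκ f z.1]

lemma integrable_loss (h0 : BddAbove (Set.range fun y ↦ φ y 0)) (f : H) :
    Integrable (fun z ↦ φ z.2 (f z.1)) ρ := by
  obtain ⟨b, hb⟩ := h0
  have hm := (measurable_loss_eval (V := Unit) hk hφm
    (stronglyMeasurable_const (b := f))).comp (measurable_prodMk_left (x := ()))
  refine Integrable.of_bound (C := b + M * (1 + κ * ‖f‖) * (κ * ‖f‖)) hm.aestronglyMeasurable
    (Filter.Eventually.of_forall fun z ↦ ?_)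
  have hM0 : 0 ≤ M := by simpa using (abs_nonneg _).trans (hM z.2 0)
  have h1 := hφ.abs_sub_le hM z.2 (f z.1) 0
  have h2 : φ z.2 0 ≤ b := hb ⟨z.2, rfl⟩
  have h3 := RKHS.abs_apply_le hκ f z.1
  rw [Real.norm_eq_abs, abs_of_nonneg (hφ.nonneg _ _)]
  simp only [abs_zero, add_zero, sub_zero] at h1
  have h4 : M * (1 + |f z.1|) * |f z.1| ≤ M * (1 + κ * ‖f‖) * (κ * ‖f‖) := by
    have := abs_nonneg (f z.1)
    exact mul_le_mul (mul_le_mul_of_nonneg_left (by linarith) hM0) h3 (abs_nonneg _)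
      (mul_nonneg hM0 (by linarith))
  linarith [le_abs_self (φ z.2 (f z.1) - φ z.2 0)]

omit [IsProbabilityMeasure ρ] hκ hM in
lemma aestronglyMeasurable_deriv_eval (f : H) :
    AEStronglyMeasurable (fun z : X × Y ↦ deriv (φ z.2) (f z.1)) ρ :=
  ((measurable_deriv_eval (V := Unit) hk hφ hφm (stronglyMeasurable_const (b := f))).comp
    (measurable_prodMk_left (x := ()))).aestronglyMeasurable

lemma integrable_grad (f : H) :
    Integrable (fun z ↦ deriv (φ z.2) (f z.1) • kernelSection H z.1) ρ := by
  refine Integrable.of_bound (C := M * (1 + κ * ‖f‖) * κ)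
    ((aestronglyMeasurable_deriv_eval hk hφ hφm f).smul
    (hk.stronglyMeasurable.comp_measurable measurable_fst).aestronglyMeasurable)
    (Filter.Eventually.of_forall fun z ↦ ?_)
  rw [norm_smul, Real.norm_eq_abs]
  have := abs_deriv_eval_le hκ hM f z
  exact mul_le_mul this (hκ _) (norm_nonneg _) ((abs_nonneg _).trans this)

/-- The reproducing property under the integral. With `g` the gradient itself, it yields the drift
‖∇ℰ(f)‖². -/
lemma integral_deriv_mul (f g : H) :
    Integrable (fun z ↦ deriv (φ z.2) (f z.1) * g z.1) ρ ∧
      ∫ z, deriv (φ z.2) (f z.1) * g z.1 ∂ρ = ⟪genGrad ρ φ f, g⟫_ℝ := by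
  have hi := integrable_grad (ρ := ρ) hk hφ hφm hκ hM f
  have e : (fun z : X × Y ↦ deriv (φ z.2) (f z.1) * g z.1)
      = fun z ↦ ⟪g, deriv (φ z.2) (f z.1) • kernelSection H z.1⟫_ℝ := by
    funext z
    rw [real_inner_smul_right, inner_kernelSection]
  rw [e]
  refine ⟨hi.const_inner g, ?_⟩
  rw [integral_inner hi, real_inner_comm, genGrad]

omit [SecondCountableTopology X] [OpensMeasurableSpace X] [TopologicalSpace X] hk hφ hφm hM in
lemma norm_genGrad_le {f : H} {G : ℝ} (hG : ∀ z : X × Y, |deriv (φ z.2) (f z.1)| ≤ G) :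
    ‖genGrad ρ φ f‖ ≤ G * κ := by
  have := norm_integral_le_of_norm_le_const (μ := ρ)
    (f := fun z ↦ deriv (φ z.2) (f z.1) • kernelSection H z.1) (C := G * κ)
    (Filter.Eventually.of_forall fun z ↦ by
      rw [norm_smul, Real.norm_eq_abs]
      exact mul_le_mul (hG z) (hκ _) (norm_nonneg _) ((abs_nonneg _).trans (hG z)))
  simpa [genGrad] using this

/-- The scalar descent inequality, integrated, with evaluations bounded by κ times the norm. -/
lemma genError_le_add (h0 : BddAbove (Set.range fun y ↦ φ y 0)) (f g : H) :
    genError ρ φ g ≤ genError ρ φ f + ⟪genGrad ρ φ f, g - f⟫_ℝ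
      + L * (κ * ‖g - f‖) ^ (1 + α) := by
  obtain ⟨hi, he⟩ := integral_deriv_mul (ρ := ρ) hk hφ hφm hκ hM f (g - f)
  have hf := integrable_loss (ρ := ρ) hk hφ hφm hκ hM h0 f
  rw [← he]
  have hle : genError ρ φ g ≤ ∫ z, (φ z.2 (f z.1) + deriv (φ z.2) (f z.1) * (g - f) z.1)
      + L * (κ * ‖g - f‖) ^ (1 + α) ∂ρ := by
    refine integral_mono (integrable_loss hk hφ hφm hκ hM h0 g)
      ((hf.add hi).add (integrable_const _)) fun z ↦ ?_
    have h1 := hφ.le_add_deriv_mul_add z.2 (f z.1) (g z.1)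
    have h2 : (g - f) z.1 = g z.1 - f z.1 := by simp
    have h3 := RKHS.abs_apply_le hκ (g - f) z.1
    have hL := hφ.L_pos
    have hα := hφ.alpha_pos
    rw [h2] at h3
    have h4 : L * |g z.1 - f z.1| ^ (1 + α) ≤ L * (κ * ‖g - f‖) ^ (1 + α) := by gcongr
    simp only [h2]
    linarith
  refine hle.trans_eq ?_
  rw [integral_add (f := fun z : X × Y ↦ φ z.2 (f z.1) + deriv (φ z.2) (f z.1) * (g - f) z.1)
    (hf.add hi) (integrable_const _), integral_add hf hi]
  simp [genError]

/-- One step of online gradient descent decreases the generalization error up to a martingale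
increment and a higher order term. -/
lemma genError_ogdStep_le (h0 : BddAbove (Set.range fun y ↦ φ y 0)) {s G : ℝ} (hs : 0 ≤ s)
    (z : X × Y) {f : H} (hG : |deriv (φ z.2) (f z.1)| ≤ G) :
    genError ρ φ (ogdStep φ s z f : H) ≤ genError ρ φ f
      - s * (deriv (φ z.2) (f z.1) * genGrad ρ φ f z.1)
      + L * (κ ^ 2 * G * s) ^ (1 + α) := by
  have h1 := genError_le_add (ρ := ρ) hk hφ hφm hκ hM h0 f (ogdStep φ s z f)
  have e : ogdStep φ s z f - f = -((s * deriv (φ z.2) (f z.1)) • kernelSection H z.1) := by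
    rw [ogdStep]; abel
  have hκ0 : 0 ≤ κ := (norm_nonneg _).trans (hκ z.1)
  have h2 : κ * ‖ogdStep φ s z f - f‖ ≤ κ ^ 2 * G * s := by
    rw [e, norm_neg, norm_smul, norm_mul, Real.norm_eq_abs, Real.norm_eq_abs, abs_of_nonneg hs]
    calc κ * (s * |deriv (φ z.2) (f z.1)| * ‖kernelSection H z.1‖) ≤ κ * (s * G * κ) := by
          gcongr
          · exact mul_nonneg hs ((abs_nonneg _).trans hG)
          · exact hκ _
      _ = _ := by ring
  have hL := hφ.L_pos
  have hα := hφ.alpha_pos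
  have h3 : L * (κ * ‖ogdStep φ s z f - f‖) ^ (1 + α) ≤ L * (κ ^ 2 * G * s) ^ (1 + α) := by gcongr
  refine h1.trans (add_le_add (le_of_eq ?_) h3)
  rw [e, inner_neg_right, real_inner_smul_right, inner_kernelSection]
  ring

/-- The exponential moment of the gradient increment. -/
lemma lintegral_exp_grad_le_one {f : H} {G τ : ℝ} (hτ : 0 ≤ τ)
    (hG : ∀ z : X × Y, |deriv (φ z.2) (f z.1)| ≤ G) (hτG : τ * (κ ^ 2 * G ^ 2) ≤ 1) :
    ∫⁻ z, ENNReal.ofReal (Real.exp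
      (-(τ * (deriv (φ z.2) (f z.1) * genGrad ρ φ f z.1)))) ∂ρ ≤ 1 := by
  obtain ⟨z0⟩ : Nonempty (X × Y) := nonempty_of_isProbabilityMeasure ρ
  have hG0 : 0 ≤ G := (abs_nonneg _).trans (hG z0)
  have hκ0 : 0 ≤ κ := (norm_nonneg _).trans (hκ z0.1)
  set N := ‖genGrad ρ φ f‖ with hN
  have hN0 : 0 ≤ N := norm_nonneg _
  have hNle : N ≤ G * κ := norm_genGrad_le hκ hG
  obtain ⟨hi, he⟩ := integral_deriv_mul (ρ := ρ) hk hφ hφm hκ hM f (genGrad ρ φ f)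
  rw [real_inner_self_eq_norm_sq, ← hN] at he
  have hY : ∀ z : X × Y, |deriv (φ z.2) (f z.1) * genGrad ρ φ f z.1| ≤ G * (κ * N) := fun z ↦ by
    rw [abs_mul]
    exact mul_le_mul (hG z) (RKHS.abs_apply_le hκ _ _) (abs_nonneg _) hG0
  have h1 : ∀ z : X × Y, |-(τ * (deriv (φ z.2) (f z.1) * genGrad ρ φ f z.1))| ≤ 1 := fun z ↦ by
    rw [abs_neg, abs_mul, abs_of_nonneg hτ]
    calc _ ≤ τ * (G * (κ * N)) := by gcongr; exact hY z
      _ ≤ τ * (G * (κ * (G * κ))) := by gcongr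
      _ = τ * (κ ^ 2 * G ^ 2) := by ring
      _ ≤ 1 := hτG
  have hsq : ∫ z, (-(τ * (deriv (φ z.2) (f z.1) * genGrad ρ φ f z.1))) ^ 2 ∂ρ
      ≤ τ ^ 2 * (G * (κ * N)) ^ 2 := by
    have hb : ∀ z : X × Y, (-(τ * (deriv (φ z.2) (f z.1) * genGrad ρ φ f z.1))) ^ 2
        ≤ τ ^ 2 * (G * (κ * N)) ^ 2 := fun z ↦ by
      rw [neg_sq, mul_pow, ← sq_abs (_ * _)]
      gcongr
      exact hY z
    have := integral_mono_of_nonneg (μ := ρ) (Filter.Eventually.of_forall fun z ↦ sq_nonneg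
      (-(τ * (deriv (φ z.2) (f z.1) * genGrad ρ φ f z.1))))
      (integrable_const (τ ^ 2 * (G * (κ * N)) ^ 2)) (Filter.Eventually.of_forall hb)
    simpa using this
  have hint : ∫ z, -(τ * (deriv (φ z.2) (f z.1) * genGrad ρ φ f z.1)) ∂ρ = -(τ * N ^ 2) := by
    rw [integral_neg, integral_const_mul, he]
  have := lintegral_exp_sub_le_one (ρ := ρ)
    (X := fun z ↦ -(τ * (deriv (φ z.2) (f z.1) * genGrad ρ φ f z.1)))
    (hi.const_mul τ).neg.aestronglyMeasurable h1 (c := 0) (by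
      rw [hint]
      -- The second moment is at most the drift τ N², by the smallness of τ; hence no compensator is
      -- needed and `c = 0`.
      have h3 : τ ^ 2 * (G * (κ * N)) ^ 2 = (τ * (κ ^ 2 * G ^ 2)) * (τ * N ^ 2) := by ring
      have h4 : (τ * (κ ^ 2 * G ^ 2)) * (τ * N ^ 2) ≤ 1 * (τ * N ^ 2) := by gcongr
      linarith)
  simpa using this

omit [SecondCountableTopology X] [OpensMeasurableSpace X] [TopologicalSpace X]
  [IsProbabilityMeasure ρ] [MeasurableSpace X] [MeasurableSpace Y] hk hφm in
-- Linear growth of the derivative makes loss differences grow quadratically. The factor 1 + ‖f -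
-- h‖² is the one that becomes bounded on every path once multiplied by the step.
lemma abs_loss_sub_le (f h : H) (z : X × Y) :
    |φ z.2 (h z.1) - φ z.2 (f z.1)|
      ≤ M * κ * (1 + 2 * κ * ‖h‖ + κ) * (1 + ‖f - h‖ ^ 2) := by
  have hM0 : 0 ≤ M := by simpa using (abs_nonneg _).trans (hM z.2 0)
  have hκ0 : 0 ≤ κ := (norm_nonneg _).trans (hκ z.1)
  have h1 := hφ.abs_sub_le hM z.2 (h z.1) (f z.1)
  have h2 := RKHS.abs_apply_le hκ h z.1
  have h3 := RKHS.abs_apply_le hκ (f - h) z.1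
  rw [RKHS.coe_sub, Pi.sub_apply] at h3
  have h4 : |f z.1| ≤ |h z.1| + |f z.1 - h z.1| := by
    have := abs_add_le (h z.1) (f z.1 - h z.1)
    simpa using this
  rw [abs_sub_comm (h z.1)] at h1
  set d := ‖f - h‖
  have hd : 0 ≤ d := norm_nonneg _
  have hh : 0 ≤ ‖h‖ := norm_nonneg _
  calc _ ≤ M * (1 + |h z.1| + |f z.1|) * |f z.1 - h z.1| := h1
    _ ≤ M * (1 + 2 * κ * ‖h‖ + κ * d) * (κ * d) := by
        refine mul_le_mul (mul_le_mul_of_nonneg_left (by linarith) hM0) h3 (abs_nonneg _) ?_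
        positivity
    _ = M * κ * ((1 + 2 * κ * ‖h‖) * d + κ * d ^ 2) := by ring
    _ ≤ M * κ * ((1 + 2 * κ * ‖h‖) * (1 + d ^ 2) + κ * (1 + d ^ 2)) := by
        gcongr
        · nlinarith [sq_nonneg (d - 1)]
        · linarith
    _ = _ := by ring

/-- The exponential moment of the loss increment. -/
lemma lintegral_exp_loss_le_one (h0 : BddAbove (Set.range fun y ↦ φ y 0)) {f h : H}
    (hmin : genError ρ φ h ≤ genError ρ φ f) {s q c τ : ℝ} (hτ : 0 ≤ τ) (hs : 0 ≤ s)
    (hc : ∀ z : X × Y, |φ z.2 (h z.1) - φ z.2 (f z.1)| ≤ c * (1 + ‖f - h‖ ^ 2)) (hc0 : 0 ≤ c)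
    (hq : s * (1 + ‖f - h‖ ^ 2) ≤ q) (hτc : τ * c * q ≤ 1 / 2) :
    ∫⁻ z, ENNReal.ofReal (Real.exp (τ * (s * (φ z.2 (h z.1) - φ z.2 (f z.1)))
      - (τ ^ 2 * (2 * c * genError ρ φ h) * (s ^ 2 * (1 + ‖f - h‖ ^ 2))
        - τ / 2 * (s * (genError ρ φ f - genError ρ φ h))))) ∂ρ ≤ 1 := by
  have hif := integrable_loss (ρ := ρ) hk hφ hφm hκ hM h0 f
  have hih := integrable_loss (ρ := ρ) hk hφ hφm hκ hM h0 h
  set d := 1 + ‖f - h‖ ^ 2 with hd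
  have hd0 : 0 ≤ d := by positivity
  set Ef := genError ρ φ f with hEf
  set Eh := genError ρ φ h with hEh
  have hi := (hih.sub hif).const_mul (τ * s)
  have hX : ∀ z : X × Y, |τ * (s * (φ z.2 (h z.1) - φ z.2 (f z.1)))| ≤ τ * (s * (c * d)) := by
    intro z
    rw [abs_mul, abs_mul, abs_of_nonneg hτ, abs_of_nonneg hs]
    gcongr
    exact hc z
  have hcs : τ * (s * (c * d)) ≤ 1 / 2 := by
    refine le_trans ?_ hτc
    calc τ * (s * (c * d)) = τ * c * (s * d) := by ring
      _ ≤ τ * c * q := by gcongr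
  refine lintegral_exp_sub_le_one (ρ := ρ)
    (X := fun z ↦ τ * (s * (φ z.2 (h z.1) - φ z.2 (f z.1)))) ?_
    (fun z ↦ (hX z).trans (hcs.trans (by norm_num))) ?_
  · refine hi.aestronglyMeasurable.congr (Filter.Eventually.of_forall fun z ↦ ?_)
    simp only [Pi.sub_apply]
    ring
  · have e1 : ∫ z, τ * (s * (φ z.2 (h z.1) - φ z.2 (f z.1))) ∂ρ = τ * (s * (Eh - Ef)) := by
      rw [integral_const_mul, integral_const_mul, integral_sub hih hif]
      rfl
    -- One factor of the square is bounded uniformly, the other by the sum of the two losses, so the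
    -- second moment is only linear in ℰ(f).
    have e2 : ∫ z, (τ * (s * (φ z.2 (h z.1) - φ z.2 (f z.1)))) ^ 2 ∂ρ
        ≤ τ * (s * (c * d)) * (τ * (s * (Eh + Ef))) := by
      have hb : ∀ z : X × Y, (τ * (s * (φ z.2 (h z.1) - φ z.2 (f z.1)))) ^ 2
          ≤ τ * (s * (c * d)) * (τ * s) * (φ z.2 (h z.1) + φ z.2 (f z.1)) := fun z ↦ by
        have h1 : |φ z.2 (h z.1) - φ z.2 (f z.1)| ≤ φ z.2 (h z.1) + φ z.2 (f z.1) := by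
          have := hφ.nonneg z.2 (h z.1)
          have := hφ.nonneg z.2 (f z.1)
          rw [abs_le]; constructor <;> linarith
        have h2 : |τ * (s * (φ z.2 (h z.1) - φ z.2 (f z.1)))|
            ≤ τ * s * (φ z.2 (h z.1) + φ z.2 (f z.1)) := by
          rw [← mul_assoc, abs_mul, abs_of_nonneg (mul_nonneg hτ hs)]
          exact mul_le_mul_of_nonneg_left h1 (mul_nonneg hτ hs)
        rw [← sq_abs, sq, mul_assoc]
        exact mul_le_mul (hX z) h2 (abs_nonneg _) ((abs_nonneg _).trans (hX z))
      have := integral_mono_of_nonneg (μ := ρ) (Filter.Eventually.of_forall fun z ↦ sq_nonneg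
        (τ * (s * (φ z.2 (h z.1) - φ z.2 (f z.1)))))
        ((hih.add hif).const_mul (τ * (s * (c * d)) * (τ * s))) (Filter.Eventually.of_forall hb)
      refine this.trans_eq ?_
      rw [integral_const_mul]
      simp only [Pi.add_apply]
      rw [integral_add hih hif, hEh, hEf, genError, genError]
      ring
    rw [e1]
    refine (add_le_add_right e2 _).trans ?_
    have hΔ : 0 ≤ τ * (s * (Ef - Eh)) := mul_nonneg hτ (mul_nonneg hs (by linarith))
    -- Write Eh + Ef = (Ef - Eh) + 2 Eh: the excess part costs half of the drift, the rest is the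
    -- compensator.
    have h3 : τ * (s * (c * d)) * (τ * (s * (Ef - Eh))) ≤ 1 / 2 * (τ * (s * (Ef - Eh))) := by
      gcongr
    have h4 : τ * (s * (c * d)) * (τ * (s * (Eh + Ef)))
        = τ * (s * (c * d)) * (τ * (s * (Ef - Eh))) + τ ^ 2 * (2 * c * Eh) * (s ^ 2 * d) := by ring
    rw [h4]
    linarith

end GeneralizationError

/-! ### Concentration along the iterates. -/

section Concentration

variable {X Y H Ω : Type*} [TopologicalSpace X] [SecondCountableTopology X] [MeasurableSpace X]
  [OpensMeasurableSpace X] [MeasurableSpace Y]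
  [NormedAddCommGroup H] [InnerProductSpace ℝ H] [CompleteSpace H] [RKHS ℝ H X ℝ]
  {φ : Y → ℝ → ℝ} {α L : ℝ} {ρ : Measure (X × Y)} [IsProbabilityMeasure ρ]
  (hk : Continuous (kernelSection H : X → H)) (hφ : IsHolderLoss φ α L)
  (hφm : Measurable (Function.uncurry φ)) {κ M : ℝ} (hκ : ∀ x, ‖kernelSection H x‖ ≤ κ)
  (hM : ∀ y t, |deriv (φ y) t| ≤ M * (1 + |t|))
  {s : ℕ → ℝ} (hs : ∀ n, 0 ≤ s n)
  [MeasurableSpace Ω] {P : Measure Ω} [IsProbabilityMeasure P] {w : ℕ → Ω → X × Y}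
  (hw : ∀ n, Measurable (w n)) (hind : iIndepFun w P) (hlaw : ∀ n, P.map (w n) = ρ)

include hk hφ hφm hκ hM hs hw hind hlaw

/-- Concentration of the weighted sum of the excess losses along the iterates. -/
lemma measureReal_lt_sum_loss_le (h0 : BddAbove (Set.range fun y ↦ φ y 0)) {h : H}
    (hmin : ∀ f : H, genError ρ φ h ≤ genError ρ φ f) {q c τ : ℝ} (hτ : 0 ≤ τ) (hc0 : 0 ≤ c)
    (hc : ∀ (f : H) (z : X × Y), |φ z.2 (h z.1) - φ z.2 (f z.1)| ≤ c * (1 + ‖f - h‖ ^ 2))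
    (hq : ∀ v t, s t * (1 + ‖ogdIter H φ s v t - h‖ ^ 2) ≤ q) (hτc : τ * c * q ≤ 1 / 2)
    (n : ℕ) (l : ℝ) :
    P.real {ω | l < ∑ t ∈ Finset.range n,
      (τ * (s t * (φ (w t ω).2 (h (w t ω).1)
          - φ (w t ω).2 (ogdIter H φ s (fun i ↦ w i ω) t (w t ω).1)))
        - (τ ^ 2 * (2 * c * genError ρ φ h)
            * (s t ^ 2 * (1 + ‖ogdIter H φ s (fun i ↦ w i ω) t - h‖ ^ 2))
          - τ / 2 * (s t * (genError ρ φ (ogdIter H φ s (fun i ↦ w i ω) t)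
            - genError ρ φ h))))} ≤ Real.exp (-l) := by
  refine measureReal_lt_sum_le (ρ := ρ) hw hind hlaw
    (u := fun t v z ↦ τ * (s t * (φ z.2 (h z.1) - φ z.2 (ogdIter H φ s v t z.1)))
        - (τ ^ 2 * (2 * c * genError ρ φ h) * (s t ^ 2 * (1 + ‖ogdIter H φ s v t - h‖ ^ 2))
          - τ / 2 * (s t * (genError ρ φ (ogdIter H φ s v t) - genError ρ φ h))))
    (fun t ↦ ?_) (fun t v v' hv ↦ ?_) (fun t v ↦ ?_) n l
  · have hg := stronglyMeasurable_ogdIter hk hφ hφm s t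
    have h1 := measurable_loss_eval hk hφm hg
    have h2 := measurable_loss_eval (V := ℕ → X × Y) hk hφm (stronglyMeasurable_const (b := h))
    have h3 := (measurable_genError hk ρ hφm hg).comp
      (measurable_fst : Measurable (Prod.fst : (ℕ → X × Y) × (X × Y) → _))
    have h4 := (hg.sub (stronglyMeasurable_const (b := h))).norm.measurable.comp
      (measurable_fst : Measurable (Prod.fst : (ℕ → X × Y) × (X × Y) → _))
    exact (((h2.sub h1).const_mul _).const_mul _).sub
      (((((h4.pow_const 2).const_add _).const_mul _).const_mul _).sub
        (((h3.sub_const _).const_mul _).const_mul _))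
  · simp only [ogdIter_congr s t hv]
  · exact lintegral_exp_loss_le_one hk hφ hφm hκ hM h0 (hmin _) hτ (hs t) (hc _) hc0 (hq v t) hτc

/-- Concentration of the gradient noise along iterates which stay in a ball. -/
lemma measureReal_lt_sum_grad_le (h : H) {R G τ : ℝ} (hτ : 0 ≤ τ) {k : ℕ}
    (hG : ∀ f : H, ‖f - h‖ ^ 2 ≤ R → ∀ z : X × Y, |deriv (φ z.2) (f z.1)| ≤ G)
    (hτG : ∀ t, k ≤ t → τ * s t * (κ ^ 2 * G ^ 2) ≤ 1) (n : ℕ) (l : ℝ) :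
    P.real {ω | l < ∑ t ∈ Finset.range n,
      (if k ≤ t ∧ ‖ogdIter H φ s (fun i ↦ w i ω) t - h‖ ^ 2 ≤ R then
        -(τ * s t * (deriv (φ (w t ω).2) (ogdIter H φ s (fun i ↦ w i ω) t (w t ω).1)
          * genGrad ρ φ (ogdIter H φ s (fun i ↦ w i ω) t) (w t ω).1)) else 0)}
      ≤ Real.exp (-l) := by
  refine measureReal_lt_sum_le (ρ := ρ) hw hind hlaw
    (u := fun t v z ↦ if k ≤ t ∧ ‖ogdIter H φ s v t - h‖ ^ 2 ≤ R then
        -(τ * s t * (deriv (φ z.2) (ogdIter H φ s v t z.1)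
          * genGrad ρ φ (ogdIter H φ s v t) z.1)) else 0)
    (fun t ↦ ?_) (fun t v v' hv ↦ ?_) (fun t v ↦ ?_) n l
  · have hg := stronglyMeasurable_ogdIter hk hφ hφm s t
    have h1 := measurable_deriv_eval hk hφ hφm hg
    have h2 := measurable_eval (X := X) (Y := Y) hk (stronglyMeasurable_genGrad hk ρ hφ hφm hg)
    have h4 := (hg.sub (stronglyMeasurable_const (b := h))).norm.measurable.comp
      (measurable_fst : Measurable (Prod.fst : (ℕ → X × Y) × (X × Y) → _))
    exact Measurable.ite ((MeasurableSet.const _).inter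
      (measurableSet_le (h4.pow_const 2) measurable_const))
      ((h1.mul h2).const_mul _).neg measurable_const
  -- The truncation to the ball involves only the current iterate, so it is determined by the past.
  · simp only [ogdIter_congr s t hv]
  · by_cases hc : k ≤ t ∧ ‖ogdIter H φ s v t - h‖ ^ 2 ≤ R
    · simp only [hc, and_self, if_true]
      exact lintegral_exp_grad_le_one hk hφ hφm hκ hM (mul_nonneg hτ (hs t)) (hG _ hc.2)
        (hτG t hc.1)
    · simp only [hc, if_false]
      simp

end Concentration

/-! ### Two deterministic recursions. -/

section Recursions

/-- A self-bounding recursion: the sequence `D` is controlled by its own running maximum with a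
factor one half. -/
lemma add_sum_le_of_recursion {D a Δ s : ℕ → ℝ} {c e τ l S : ℝ} {T : ℕ} (hs : ∀ n, 0 ≤ s n)
    (hΔ : ∀ n, 0 ≤ Δ n) (hc : 0 ≤ c) (he : 0 ≤ e) (hτ : 0 < τ) (hl : 0 ≤ l)
    (hS : ∀ n, ∑ t ∈ Finset.range n, s t ^ 2 ≤ S) (hτS : 2 * τ * e * S ≤ 1 / 2)
    (hD : ∀ n, D n ≤ c + 2 * ∑ t ∈ Finset.range n, a t)
    (ha : ∀ n ≤ T, ∑ t ∈ Finset.range n, (τ * a t - (τ ^ 2 * e * (s t ^ 2 * (1 + D t))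
      - τ / 2 * (s t * Δ t))) ≤ l) :
    ∀ n ≤ T, D n + ∑ t ∈ Finset.range n, s t * Δ t ≤ 2 * c + 1 + 4 * l / τ := by
  intro n
  set R := 2 * c + 1 + 4 * l / τ with hR
  have hR0 : 0 ≤ R := by positivity
  induction n using Nat.strong_induction_on with
  | _ n ih =>
    intro hn
    have h1 := ha n hn
    simp only [Finset.sum_sub_distrib, ← Finset.mul_sum] at h1
    -- The bound at earlier times is fed into the variance term, of which `hτS` lets only half
    -- return.
    have h2 : ∑ t ∈ Finset.range n, s t ^ 2 * (1 + D t) ≤ S * (1 + R) := by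
      calc _ ≤ ∑ t ∈ Finset.range n, s t ^ 2 * (1 + R) := by
            refine Finset.sum_le_sum fun t ht ↦ ?_
            have ht' := Finset.mem_range.1 ht
            have := ih t ht' (ht'.le.trans hn)
            have h3 : 0 ≤ ∑ i ∈ Finset.range t, s i * Δ i :=
              Finset.sum_nonneg fun i _ ↦ mul_nonneg (hs i) (hΔ i)
            gcongr
            linarith
        _ = (∑ t ∈ Finset.range n, s t ^ 2) * (1 + R) := by rw [Finset.sum_mul]
        _ ≤ _ := by gcongr; exact hS n
    have h3 : 2 * τ * e * ∑ t ∈ Finset.range n, s t ^ 2 * (1 + D t) ≤ 1 / 2 * (1 + R) :=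
      calc _ ≤ 2 * τ * e * (S * (1 + R)) := by gcongr
        _ = (2 * τ * e * S) * (1 + R) := by ring
        _ ≤ _ := by gcongr
    have h4 := hD n
    set A := ∑ t ∈ Finset.range n, a t
    set W := ∑ t ∈ Finset.range n, s t * Δ t
    set V := ∑ t ∈ Finset.range n, s t ^ 2 * (1 + D t)
    have h5 : 2 * A + W ≤ 2 * τ * e * V + 2 * l / τ := by
      have : τ * (2 * A + W) ≤ τ * (2 * τ * e * V + 2 * l / τ) := by
        have : τ * (2 * τ * e * V + 2 * l / τ) = 2 * (τ ^ 2 * e * V + l) := by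
          field_simp
        rw [this]
        linarith
      exact le_of_mul_le_mul_left this hτ
    -- `R` is chosen as the fixed point of this equation.
    have h6 : R = c + 1 / 2 * (1 + R) + 2 * l / τ := by rw [hR]; ring
    linarith

/-- From a weighted average to the last term, for a sequence which is almost decreasing. -/
lemma last_le_of_recursion {Δ y s : ℕ → ℝ} {σ r b R : ℝ} {m T : ℕ} (hmT : m < T)
    (hΔ : ∀ n, 0 ≤ Δ n) (hs : ∀ n, 0 ≤ s n) (hσ : 0 < σ) (hσs : ∀ t < T, σ ≤ s t)
    (hr : 0 ≤ r) (hstep : ∀ t, m ≤ t → t < T → Δ (t + 1) ≤ Δ t + y t + r)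
    (hy : ∀ k, m ≤ k → k < T → ∑ t ∈ Finset.Ico k T, y t ≤ b)
    (hsum : ∑ t ∈ Finset.range T, s t * Δ t ≤ R) :
    Δ T ≤ R / (σ * ((T : ℝ) - m)) + b + ((T : ℝ) - m) * r := by
  have hpos : 0 < (T : ℝ) - m := sub_pos.2 (by exact_mod_cast hmT)
  have h1 : ∀ k, m ≤ k → k ≤ T → ∀ n, k ≤ n → n ≤ T →
      Δ n ≤ Δ k + ∑ t ∈ Finset.Ico k n, y t + ((n : ℝ) - k) * r := by
    intro k hk _ n hkn
    induction n, hkn using Nat.le_induction with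
    | base => simp
    | succ n hkn ih =>
      intro hn
      have h2 := ih (by omega)
      have h3 := hstep n (by omega) (by omega)
      rw [Finset.sum_Ico_succ_top hkn]
      push_cast
      linarith
  -- `W` lies below every `Δ k` with m ≤ k < T, hence below their weighted average.
  set W := Δ T - b - ((T : ℝ) - m) * r with hW
  have h2 : ∀ k ∈ Finset.Ico m T, W ≤ Δ k := fun k hk ↦ by
    rw [Finset.mem_Ico] at hk
    have h3 := h1 k hk.1 hk.2.le T hk.2.le le_rfl
    have h4 := hy k hk.1 hk.2
    have h5 : ((T : ℝ) - k) * r ≤ ((T : ℝ) - m) * r := by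
      gcongr
      exact_mod_cast hk.1
    linarith
  have h3 : ((T : ℝ) - m) * (σ * W) ≤ R := by
    calc ((T : ℝ) - m) * (σ * W) = ∑ _k ∈ Finset.Ico m T, σ * W := by
          rw [Finset.sum_const, Nat.card_Ico, nsmul_eq_mul, Nat.cast_sub hmT.le]
      _ ≤ ∑ k ∈ Finset.Ico m T, s k * Δ k := Finset.sum_le_sum fun k hk ↦
          (mul_le_mul_of_nonneg_left (h2 k hk) hσ.le).trans
            (mul_le_mul_of_nonneg_right (hσs k (Finset.mem_Ico.1 hk).2) (hΔ k))
      _ ≤ ∑ k ∈ Finset.range T, s k * Δ k := by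
          refine Finset.sum_le_sum_of_subset_of_nonneg (fun k hk ↦ ?_)
            fun k _ _ ↦ mul_nonneg (hs k) (hΔ k)
          exact Finset.mem_range.2 (Finset.mem_Ico.1 hk).2
      _ ≤ R := hsum
  have h4 : W ≤ R / (σ * ((T : ℝ) - m)) := by
    rw [le_div_iff₀ (by positivity)]
    linarith
  linarith

end Recursions

/-! ### Polynomial step sizes, shifted to start at index 0. -/

section StepSizes

variable {η₁ θ : ℝ}

lemma polyStep_pos (hη : 0 < η₁) (n : ℕ) : 0 < polyStep η₁ θ (n + 1) := by
  unfold polyStep; positivity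

lemma antitone_polyStep (hη : 0 < η₁) (hθ : 0 < θ) :
    Antitone fun n : ℕ ↦ polyStep η₁ θ (n + 1) := by
  intro m n hmn
  simp only [polyStep]
  have : ((n + 1 : ℕ) : ℝ) ^ (-θ) ≤ ((m + 1 : ℕ) : ℝ) ^ (-θ) :=
    Real.rpow_le_rpow_of_nonpos (by positivity) (by exact_mod_cast Nat.succ_le_succ hmn)
      (by linarith)
  gcongr

lemma exists_sum_polyStep_sq_le (hθ : 1 / 2 < θ) :
    ∃ S : ℝ, ∀ n, ∑ t ∈ Finset.range n, polyStep η₁ θ (t + 1) ^ 2 ≤ S := by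
  have h1 : Summable fun n : ℕ ↦ ((n + 1 : ℕ) : ℝ) ^ (-(2 * θ)) :=
    (summable_nat_add_iff 1).2 (Real.summable_nat_rpow.2 (by linarith))
  have h2 : Summable fun n : ℕ ↦ polyStep η₁ θ (n + 1) ^ 2 := by
    refine (h1.mul_left (η₁ ^ 2)).congr fun n ↦ ?_
    rw [polyStep, mul_pow, ← Real.rpow_mul_natCast (by positivity)]
    congr 2
    push_cast
    ring
  exact ⟨_, fun n ↦ h2.sum_le_tsum _ fun i _ ↦ sq_nonneg _⟩

lemma le_polyStep (hη : 0 < η₁) (hθ : 0 < θ) {t T : ℕ} (ht : t < T) :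
    η₁ * (T : ℝ) ^ (-θ) ≤ polyStep η₁ θ (t + 1) := by
  rw [polyStep]
  have : (T : ℝ) ^ (-θ) ≤ ((t + 1 : ℕ) : ℝ) ^ (-θ) :=
    Real.rpow_le_rpow_of_nonpos (by positivity) (by exact_mod_cast ht) (by linarith)
  gcongr

lemma polyStep_half_le (hη : 0 < η₁) (hθ : 0 < θ) (hθ1 : θ ≤ 1) {T : ℕ} (hT : 0 < T) :
    polyStep η₁ θ (T / 2 + 1) ≤ 2 * η₁ * (T : ℝ) ^ (-θ) := by
  rw [polyStep]
  have hT' : (0 : ℝ) < T := by exact_mod_cast hT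
  have h1 : (T : ℝ) / 2 ≤ ((T / 2 + 1 : ℕ) : ℝ) := by
    have : T ≤ 2 * (T / 2 + 1) := by omega
    have : (T : ℝ) ≤ 2 * ((T / 2 + 1 : ℕ) : ℝ) := by exact_mod_cast this
    linarith
  have h2 : ((T / 2 + 1 : ℕ) : ℝ) ^ (-θ) ≤ ((T : ℝ) / 2) ^ (-θ) :=
    Real.rpow_le_rpow_of_nonpos (by positivity) h1 (by linarith)
  have h3 : ((T : ℝ) / 2) ^ (-θ) ≤ 2 * (T : ℝ) ^ (-θ) := by
    rw [Real.div_rpow hT'.le zero_le_two, Real.rpow_neg zero_le_two θ, div_inv_eq_mul, mul_comm]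
    gcongr
    simpa using Real.rpow_le_rpow_of_exponent_le one_le_two hθ1
  calc _ ≤ η₁ * (2 * (T : ℝ) ^ (-θ)) := by gcongr; exact h2.trans h3
    _ = _ := by ring

end StepSizes

/-! ### From the weighted average to the last iterate. -/

section LastIterate

universe u

variable {X Y H : Type*} [TopologicalSpace X] [SecondCountableTopology X] [MeasurableSpace X]
  [OpensMeasurableSpace X] [MeasurableSpace Y]
  [NormedAddCommGroup H] [InnerProductSpace ℝ H] [CompleteSpace H] [RKHS ℝ H X ℝ]
  {φ : Y → ℝ → ℝ} {α L : ℝ} {ρ : Measure (X × Y)} [IsProbabilityMeasure ρ]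

/-- The pathwise estimate behind the deviation bound for the last iterate. -/
lemma excess_le_of_path (hk : Continuous (kernelSection H : X → H))
    (hφ : IsHolderLoss φ α L) (hφm : Measurable (Function.uncurry φ)) {κ M : ℝ}
    (hκ : ∀ x, ‖kernelSection H x‖ ≤ κ) (hM : ∀ y t, |deriv (φ y) t| ≤ M * (1 + |t|))
    (h0 : BddAbove (Set.range fun y ↦ φ y 0)) {h : H}
    (hmin : ∀ f : H, genError ρ φ h ≤ genError ρ φ f)
    {s : ℕ → ℝ} (hs : ∀ n, 0 < s n) (hanti : Antitone s) {R G μ l : ℝ} (hG0 : 0 ≤ G)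
    (hGf : ∀ f : H, ‖f - h‖ ^ 2 ≤ R → ∀ z : X × Y, |deriv (φ z.2) (f z.1)| ≤ G)
    (hμ : 0 < μ) {v : ℕ → X × Y} {m T : ℕ} (hmT : m < T)
    (hrec : ∀ n ≤ T, ‖ogdIter H φ s v n - h‖ ^ 2 + ∑ t ∈ Finset.range n,
      s t * (genError ρ φ (ogdIter H φ s v t) - genError ρ φ h) ≤ R)
    (hgrad : ∀ k, m ≤ k → k < T → ∑ t ∈ Finset.range T,
      (if k ≤ t ∧ ‖ogdIter H φ s v t - h‖ ^ 2 ≤ R then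
        -(μ * s t * (deriv (φ (v t).2) (ogdIter H φ s v t (v t).1)
          * genGrad ρ φ (ogdIter H φ s v t) (v t).1)) else 0) ≤ l) :
    genError ρ φ (ogdIter H φ s v T) - genError ρ φ h
      ≤ R / (s (T - 1) * ((T : ℝ) - m)) + l / μ + T * (L * (κ ^ 2 * G * s m) ^ (1 + α)) := by
  have hs0 : ∀ n, 0 ≤ s n := fun n ↦ (hs n).le
  have hα := hφ.alpha_pos
  have hL := hφ.L_pos
  have hsm := hs0 m
  have hΔ0 : ∀ n, 0 ≤ genError ρ φ (ogdIter H φ s v n) - genError ρ φ h :=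
    fun n ↦ sub_nonneg.2 (hmin _)
  have hDR : ∀ t ≤ T, ‖ogdIter H φ s v t - h‖ ^ 2 ≤ R := fun t ht ↦ by
    have h2 := Finset.sum_nonneg fun i (_ : i ∈ Finset.range t) ↦ mul_nonneg (hs0 i) (hΔ0 i)
    linarith [hrec t ht]
  have hsumR : ∑ t ∈ Finset.range T, s t * (genError ρ φ (ogdIter H φ s v t) - genError ρ φ h)
      ≤ R := by
    linarith [hrec T le_rfl, sq_nonneg ‖ogdIter H φ s v T - h‖]
  have hy : ∀ k, m ≤ k → k < T → ∑ t ∈ Finset.Ico k T,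
      -(s t * (deriv (φ (v t).2) (ogdIter H φ s v t (v t).1)
          * genGrad ρ φ (ogdIter H φ s v t) (v t).1)) ≤ l / μ := by
    intro k hk1 hk2
    have h1 := hgrad k hk1 hk2
    -- The path stays in the ball up to time `T`, so the truncation is inactive and the sum is the
    -- one over [k, T).
    rw [← Finset.sum_filter] at h1
    rw [le_div_iff₀ hμ, Finset.sum_mul]
    refine le_trans (le_of_eq (Finset.sum_congr ?_ fun t _ ↦ by ring)) h1
    ext t
    simp only [Finset.mem_filter, Finset.mem_range, Finset.mem_Ico]
    exact ⟨fun h3 ↦ ⟨h3.2, h3.1, hDR t h3.2.le⟩, fun h3 ↦ ⟨h3.2.1, h3.1⟩⟩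
  have hr0 : 0 ≤ L * (κ ^ 2 * G * s m) ^ (1 + α) := by positivity
  have hstep : ∀ t, m ≤ t → t < T →
      genError ρ φ (ogdIter H φ s v (t + 1)) - genError ρ φ h
        ≤ genError ρ φ (ogdIter H φ s v t) - genError ρ φ h
          + -(s t * (deriv (φ (v t).2) (ogdIter H φ s v t (v t).1)
            * genGrad ρ φ (ogdIter H φ s v t) (v t).1)) + L * (κ ^ 2 * G * s m) ^ (1 + α) := by
    intro t ht1 ht2
    have h1 := genError_ogdStep_le (ρ := ρ) hk hφ hφm hκ hM h0 (hs0 t) (v t)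
      (hGf _ (hDR t ht2.le) (v t))
    have h2 : L * (κ ^ 2 * G * s t) ^ (1 + α) ≤ L * (κ ^ 2 * G * s m) ^ (1 + α) := by
      have h3 : s t ≤ s m := hanti ht1
      have hst := hs0 t
      gcongr
    have h5 : ogdIter H φ s v (t + 1) = ogdStep φ (s t) (v t) (ogdIter H φ s v t) := rfl
    rw [h5]
    linarith
  refine (last_le_of_recursion (σ := s (T - 1)) hmT hΔ0 hs0 (hs _)
    (fun t ht ↦ hanti (by omega)) hr0 hstep hy hsumR).trans ?_
  gcongr
  linarith [(Nat.cast_nonneg m : (0 : ℝ) ≤ m)]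

set_option maxHeartbeats 1000000 in
/-- Deviation bound for the last iterate of online gradient descent with decreasing, square
summable step sizes. -/
lemma exists_measureReal_lt_excess_le (hk : Continuous (kernelSection H : X → H))
    (hφ : IsHolderLoss φ α L) (hφm : Measurable (Function.uncurry φ)) {κ : ℝ}
    (hκ : ∀ x, ‖kernelSection H x‖ ≤ κ) (h0 : BddAbove (Set.range fun y ↦ φ y 0)) {h : H}
    (hmin : ∀ f : H, genError ρ φ h ≤ genError ρ φ f)
    (hbdd : BddAbove (Set.range fun z : X × Y ↦ φ z.2 (h z.1)))
    {s : ℕ → ℝ} (hs : ∀ n, 0 < s n) (hanti : Antitone s)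
    (hsA : s 0 * (constA α L * κ ^ 2) ≤ 1)
    {S : ℝ} (hS : ∀ n, ∑ t ∈ Finset.range n, s t ^ 2 ≤ S) :
    ∃ c₁ c₂ c₃ : ℝ, 0 ≤ c₁ ∧ 0 ≤ c₂ ∧ 0 ≤ c₃ ∧
      ∀ (Ω : Type u) [MeasurableSpace Ω] (P : Measure Ω) [IsProbabilityMeasure P]
        (w : ℕ → Ω → X × Y), (∀ n, Measurable (w n)) → iIndepFun w P →
        (∀ n, P.map (w n) = ρ) → ∀ T : ℕ, 1 ≤ T → ∀ l : ℝ, 0 ≤ l →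
          P.real {ω | c₁ * (1 + l) / (s (T - 1) * ((T : ℝ) - (T / 2 : ℕ)))
              + s (T / 2) * (c₂ * (1 + c₁ * (1 + l)) * l)
              + T * (c₃ * (1 + c₁ * (1 + l)) * s (T / 2) ^ (1 + α))
            < genError ρ φ (ogdIter H φ s (fun i ↦ w i ω) T) - genError ρ φ h}
          ≤ 2 * T * Real.exp (-l) := by
  obtain ⟨B, hB, hderiv⟩ := hφ.exists_deriv_sq_le
  obtain ⟨M, hM1, hM⟩ := hφ.exists_abs_deriv_le h0
  obtain ⟨b, hb'⟩ := hbdd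
  have hb : ∀ z : X × Y, φ z.2 (h z.1) ≤ b := fun z ↦ hb' ⟨z, rfl⟩
  have hne : Nonempty (X × Y) := nonempty_of_isProbabilityMeasure ρ
  have hs0 : ∀ n, 0 ≤ s n := fun n ↦ (hs n).le
  have hA : 0 < constA α L := hφ.constA_pos
  have hα := hφ.alpha_pos
  have hL := hφ.L_pos
  obtain ⟨z0⟩ := id hne
  have hκ0 : 0 ≤ κ := (norm_nonneg _).trans (hκ z0.1)
  have hb0 : 0 ≤ b := (hφ.nonneg _ _).trans (hb z0)
  have hS0 : 0 ≤ S := by simpa using hS 0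
  have hh0 : 0 ≤ ‖h‖ := norm_nonneg h
  have hE0 : 0 ≤ genError ρ φ h := integral_nonneg fun z ↦ hφ.nonneg _ _
  have hM0 : 0 ≤ M := zero_le_one.trans hM1
  have hstart := hs0 0
  obtain ⟨Q, hQ⟩ : ∃ r, r = s 0 * ‖h‖ ^ 2 + (2 * b + s 0 * κ ^ 2 * B) * S := ⟨_, rfl⟩
  have hQ0 : 0 ≤ Q := by rw [hQ]; positivity
  obtain ⟨q, hq⟩ : ∃ r, r = s 0 + Q := ⟨_, rfl⟩
  have hq0 : 0 ≤ q := by rw [hq]; positivity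
  obtain ⟨c, hc⟩ : ∃ r, r = M * κ * (1 + 2 * κ * ‖h‖ + κ) := ⟨_, rfl⟩
  have hc0 : 0 ≤ c := by rw [hc]; positivity
  obtain ⟨e, he⟩ : ∃ r, r = 2 * c * genError ρ φ h := ⟨_, rfl⟩
  have he0 : 0 ≤ e := by rw [he]; positivity
  obtain ⟨a, ha⟩ : ∃ r, r = ‖h‖ ^ 2 + κ ^ 2 * (constA α L * Q + B * S) := ⟨_, rfl⟩
  have ha0 : 0 ≤ a := by rw [ha]; positivity
  -- Small enough for both the boundedness condition τcq ≤ 1/2 and the recursion condition 2τeS ≤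
  -- 1/2; the 1 keeps the denominator positive.
  obtain ⟨τ, hτ⟩ : ∃ r, r = 1 / (2 * c * q + 4 * e * S + 1) := ⟨_, rfl⟩
  have hden : 0 < 2 * c * q + 4 * e * S + 1 := by positivity
  have hτ0 : 0 < τ := by rw [hτ]; positivity
  have hτden : τ * (2 * c * q + 4 * e * S + 1) = 1 := by
    rw [hτ, one_div_mul_cancel hden.ne']
  have hcq : 0 ≤ τ * (c * q) := by positivity
  have heS : 0 ≤ τ * (e * S) := by positivity
  have hτc : τ * c * q ≤ 1 / 2 := by linarith
  have hτe : 2 * τ * e * S ≤ 1 / 2 := by linarith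
  obtain ⟨g, hg⟩ : ∃ r, r = M * (1 + κ * ‖h‖ + κ) := ⟨_, rfl⟩
  have hg1 : 1 ≤ g := hg ▸ one_le_mul_of_one_le_of_one_le hM1 (by nlinarith [mul_nonneg hκ0 hh0])
  have hg0 : 0 ≤ g := zero_le_one.trans hg1
  have hcf : ∀ (f : H) (z : X × Y),
      |φ z.2 (h z.1) - φ z.2 (f z.1)| ≤ c * (1 + ‖f - h‖ ^ 2) := fun f z ↦
    hc ▸ abs_loss_sub_le hφ hκ hM f h z
  have hqf : ∀ v t, s t * (1 + ‖ogdIter H φ s v t - h‖ ^ 2) ≤ q := fun v t ↦ by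
    have h1 := step_mul_norm_sq_le hφ hκ hB hderiv hs0 hanti hsA hA.le hb hS v t
    have h2 : s t ≤ s 0 := hanti (Nat.zero_le t)
    rw [mul_add, mul_one, hq, hQ]
    exact add_le_add h2 h1
  have hDf : ∀ v n, ‖ogdIter H φ s v n - h‖ ^ 2 ≤ a + 2 * ∑ t ∈ Finset.range n,
      s t * (φ (v t).2 (h (v t).1) - φ (v t).2 (ogdIter H φ s v t (v t).1)) := fun v n ↦ by
    rw [ha, hQ]
    exact norm_sq_le_add_sum hφ hκ hB hderiv hs0 hanti hsA hA.le hb hS v n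
  refine ⟨2 * a + 1 + 4 / τ, κ ^ 2 * g ^ 2 + 1, L * (κ ^ 2) ^ (1 + α) * g ^ 2, by positivity,
    by positivity, by positivity, fun Ω _ P _ w hw hind hlaw T hT l hl ↦ ?_⟩
  have hRle : 2 * a + 1 + 4 * l / τ ≤ (2 * a + 1 + 4 / τ) * (1 + l) := by
    have h1 : (2 * a + 1 + 4 / τ) * (1 + l)
        = 2 * a + 1 + 4 * l / τ + (4 / τ + (2 * a + 1) * l) := by ring
    have h2 : 0 ≤ 4 / τ + (2 * a + 1) * l := by positivity
    linarith
  have hR0 : 0 ≤ (2 * a + 1 + 4 / τ) * (1 + l) := by positivity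
  generalize (2 * a + 1 + 4 / τ) * (1 + l) = R at hRle hR0 ⊢
  -- A bound for the derivatives on the ball of squared radius `R` around `h`.
  obtain ⟨G, hG⟩ : ∃ r, r = g * √(1 + R) := ⟨_, rfl⟩
  have hsq1 : 1 ≤ √(1 + R) := Real.one_le_sqrt.2 (by linarith)
  have hG1 : 1 ≤ G := hG ▸ one_le_mul_of_one_le_of_one_le hg1 hsq1
  have hG0 : 0 ≤ G := zero_le_one.trans hG1
  have hG2 : G ^ 2 = g ^ 2 * (1 + R) := by rw [hG, mul_pow, Real.sq_sqrt (by linarith)]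
  have hGf : ∀ f : H, ‖f - h‖ ^ 2 ≤ R → ∀ z : X × Y, |deriv (φ z.2) (f z.1)| ≤ G := by
    intro f hf z
    refine (abs_deriv_eval_le hκ hM f z).trans ?_
    rw [hG, hg, mul_assoc]
    have h1 : ‖f - h‖ ≤ √(1 + R) := Real.le_sqrt_of_sq_le (by linarith)
    have h2 : ‖f‖ ≤ ‖h‖ + ‖f - h‖ := by
      have := norm_add_le h (f - h)
      simpa using this
    have h3 : κ * ‖f‖ ≤ κ * (‖h‖ + √(1 + R)) := by gcongr; linarith
    refine mul_le_mul_of_nonneg_left ?_ hM0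
    nlinarith [mul_nonneg hκ0 hh0]
  have hmT : T / 2 < T := by omega
  generalize T / 2 = m at hmT ⊢
  have hsm := hs m
  -- Essentially the largest exponent for which the drift dominates from time `m` on; the added 1
  -- covers κ = 0.
  obtain ⟨μ, hμ⟩ : ∃ r, r = 1 / (s m * (κ ^ 2 * G ^ 2 + 1)) := ⟨_, rfl⟩
  have hμ0 : 0 < μ := by rw [hμ]; positivity
  have hμs : ∀ t, m ≤ t → μ * s t * (κ ^ 2 * G ^ 2) ≤ 1 := by
    intro t ht
    have h1 : s t ≤ s m := hanti ht
    have h2 : μ * s m * (κ ^ 2 * G ^ 2 + 1) = 1 := by rw [hμ]; field_simp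
    have h3 : μ * s t * (κ ^ 2 * G ^ 2) ≤ μ * s m * (κ ^ 2 * G ^ 2) := by gcongr
    have h4 : 0 ≤ μ * s m := by positivity
    linarith
  have hp₁ := fun n ↦ measureReal_lt_sum_loss_le hk hφ hφm hκ hM hs0 hw hind hlaw h0 hmin hτ0.le
    hc0 hcf hqf hτc n l
  have hp₂ := fun k (hk' : m ≤ k) ↦ measureReal_lt_sum_grad_le hk hφ hφm hκ hM hs0 hw hind hlaw h
    hμ0.le hGf (fun t ht ↦ hμs t (hk'.trans ht)) T l
  rw [← he] at hp₁
  -- Union bound over the `T` horizons of the loss sums and the `T - m` starting points of the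
  -- gradient sums: at most `2T` events.
  have hu₁ := (measureReal_biUnion_finset_le (μ := P) (Finset.Icc 1 T) _).trans
    (Finset.sum_le_sum fun n _ ↦ hp₁ n)
  have hu₂ := (measureReal_biUnion_finset_le (μ := P) (Finset.Ico m T) _).trans
    (Finset.sum_le_sum fun k hk' ↦ hp₂ k (Finset.mem_Ico.1 hk').1)
  have hu₃ := (measureReal_union_le _ _).trans (add_le_add hu₁ hu₂)
  refine le_trans (measureReal_mono ?_) (hu₃.trans ?_)
  · intro ω hω
    by_contra hcon
    simp only [Set.mem_union, Set.mem_iUnion, not_or, not_exists, Finset.mem_Icc,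
      Finset.mem_Ico, Set.mem_ofPred_eq, not_lt] at hcon hω
    obtain ⟨hg₁, hg₂⟩ := hcon
    refine absurd hω (not_lt.2 ?_)
    refine (excess_le_of_path hk hφ hφm hκ hM h0 hmin hs hanti hG0 hGf hμ0 hmT (fun n hn ↦ ?_)
      fun k hk1 hk2 ↦ hg₂ k ⟨hk1, hk2⟩).trans ?_
    · refine (add_sum_le_of_recursion hs0 (fun n ↦ sub_nonneg.2 (hmin _)) ha0 he0 hτ0 hl hS hτe
        (hDf fun i ↦ w i ω) (T := T) (fun n hn ↦ ?_) n hn).trans hRle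
      rcases Nat.eq_zero_or_pos n with rfl | hn0
      · simpa using hl
      · exact hg₁ n ⟨hn0, hn⟩
    · have h1 : l / μ ≤ s m * ((κ ^ 2 * g ^ 2 + 1) * (1 + R) * l) := by
        have h2 : l / μ = s m * ((κ ^ 2 * (g ^ 2 * (1 + R)) + 1) * l) := by
          rw [hμ, ← hG2]
          field_simp
        rw [h2]
        gcongr
        linarith
      have h3 : L * (κ ^ 2 * G * s m) ^ (1 + α)
          ≤ L * (κ ^ 2) ^ (1 + α) * g ^ 2 * (1 + R) * s m ^ (1 + α) := by
        -- As G ≥ 1 and α ≤ 1, the power is at most G², which is linear in `R`.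
        have h4 : G ^ (1 + α) ≤ g ^ 2 * (1 + R) := by
          rw [← hG2, ← Real.rpow_two]
          exact Real.rpow_le_rpow_of_exponent_le hG1 (by linarith [hφ.alpha_le_one])
        calc L * (κ ^ 2 * G * s m) ^ (1 + α)
            = L * (κ ^ 2) ^ (1 + α) * G ^ (1 + α) * s m ^ (1 + α) := by
              rw [Real.mul_rpow (by positivity) hsm.le, Real.mul_rpow (by positivity) hG0]
              ring
          _ ≤ L * (κ ^ 2) ^ (1 + α) * (g ^ 2 * (1 + R)) * s m ^ (1 + α) := by gcongr
          _ = _ := by ring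
      gcongr
  · simp only [Finset.sum_const, Nat.card_Icc, Nat.card_Ico, nsmul_eq_mul]
    have h1 : ((T - m : ℕ) : ℝ) ≤ T := by exact_mod_cast Nat.sub_le T m
    have h2 := Real.exp_pos (-l)
    have h3 := mul_le_mul_of_nonneg_right h1 h2.le
    simp only [Nat.add_sub_cancel]
    linarith

end LastIterate

/-! ### Rates for polynomial step sizes. -/

/-- The deviation bound of `exists_measureReal_lt_excess_le` for polynomially decaying step sizes,
in closed form. -/
lemma polyStep_deviation_le {c₁ c₂ c₃ η₁ θ α : ℝ} (hc₁ : 0 ≤ c₁) (hc₂ : 0 ≤ c₂) (hc₃ : 0 ≤ c₃)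
    (hη : 0 < η₁) (hθ : 1 / 2 < θ) (hθ1 : θ < 1) (hα : 0 < α) {T : ℕ} (hT : 2 ≤ T) {l₀ l : ℝ}
    (hl₀ : 1 / 2 ≤ l₀) (hl0 : 0 ≤ l) (hl : l ≤ 2 * l₀) :
    c₁ * (1 + l) / (polyStep η₁ θ (T - 1 + 1) * ((T : ℝ) - (T / 2 : ℕ)))
        + polyStep η₁ θ (T / 2 + 1) * (c₂ * (1 + c₁ * (1 + l)) * l)
        + T * (c₃ * (1 + c₁ * (1 + l)) * polyStep η₁ θ (T / 2 + 1) ^ (1 + α))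
      ≤ (16 * c₁ / η₁ + 4 * η₁ * c₂ * (2 + 4 * c₁)
          + 2 * c₃ * (2 + 4 * c₁) * (2 * η₁) ^ (1 + α) + 1)
        * ((T : ℝ) ^ max (θ - 1) (1 - (1 + α) * θ) * l₀ ^ 2) := by
  have hT0 : 0 < (T : ℝ) := by positivity
  have hT1 : 1 ≤ (T : ℝ) := by exact_mod_cast (by omega : 1 ≤ T)
  have hl₀0 : 0 ≤ l₀ := by linarith
  have hsq : l₀ ≤ 2 * l₀ ^ 2 := by nlinarith
  have hs0 := polyStep_pos (θ := θ) hη (T / 2)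
  have hs1 := le_polyStep (θ := θ) hη (by linarith) (show T - 1 < T by omega)
  have hs2 := polyStep_half_le (θ := θ) hη (by linarith) hθ1.le (show 0 < T by omega)
  have hp1 : (T : ℝ) ^ (θ - 1) ≤ (T : ℝ) ^ max (θ - 1) (1 - (1 + α) * θ) :=
    Real.rpow_le_rpow_of_exponent_le hT1 (le_max_left _ _)
  have hp2 : (T : ℝ) ^ (1 - (1 + α) * θ) ≤ (T : ℝ) ^ max (θ - 1) (1 - (1 + α) * θ) :=
    Real.rpow_le_rpow_of_exponent_le hT1 (le_max_right _ _)
  -- Since θ > 1/2, the gradient noise term never dominates.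
  have hp3 : (T : ℝ) ^ (-θ) ≤ (T : ℝ) ^ (θ - 1) :=
    Real.rpow_le_rpow_of_exponent_le hT1 (by linarith)
  have hp0 : 0 ≤ (T : ℝ) ^ max (θ - 1) (1 - (1 + α) * θ) := by positivity
  generalize (T : ℝ) ^ max (θ - 1) (1 - (1 + α) * θ) = p at hp1 hp2 hp0 ⊢
  generalize polyStep η₁ θ (T - 1 + 1) = σ at hs1 ⊢
  generalize polyStep η₁ θ (T / 2 + 1) = s at hs0 hs2 ⊢
  have hR : 1 + c₁ * (1 + l) ≤ (2 + 4 * c₁) * l₀ := by nlinarith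
  have hR0 : 0 ≤ 1 + c₁ * (1 + l) := by positivity
  have h1 : c₁ * (1 + l) / (σ * ((T : ℝ) - (T / 2 : ℕ))) ≤ 16 * c₁ / η₁ * (p * l₀ ^ 2) := by
    have e1 : (T : ℝ) / 2 ≤ (T : ℝ) - (T / 2 : ℕ) := by
      have := @Nat.cast_div_le ℝ _ _ _ T 2
      push_cast at this
      linarith
    have e2 : (T : ℝ) ^ (θ - 1) * ((T : ℝ) ^ (-θ) * T) = 1 := by
      rw [← Real.rpow_add_one hT0.ne', ← Real.rpow_add hT0]
      simp
    have e3 : 0 < (T : ℝ) ^ (-θ) := by positivity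
    have e0 : 0 ≤ σ := le_trans (by positivity) hs1
    have e4 : η₁ * (T : ℝ) ^ (-θ) * (T / 2) ≤ σ * ((T : ℝ) - (T / 2 : ℕ)) := by gcongr
    have e5 : c₁ * (1 + l) ≤ c₁ * (4 * l₀) := by gcongr; linarith
    calc c₁ * (1 + l) / (σ * ((T : ℝ) - (T / 2 : ℕ)))
        ≤ c₁ * (4 * l₀) / (η₁ * (T : ℝ) ^ (-θ) * (T / 2)) := by gcongr
      _ = 8 * c₁ / η₁ * ((T : ℝ) ^ (θ - 1) * l₀) := by
          rw [div_eq_iff (by positivity)]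
          calc c₁ * (4 * l₀) = 4 * c₁ * l₀ * 1 := by ring
            _ = 4 * c₁ * l₀ * ((T : ℝ) ^ (θ - 1) * ((T : ℝ) ^ (-θ) * T)) := by rw [e2]
            _ = _ := by field_simp; ring
      _ ≤ 8 * c₁ / η₁ * (p * (2 * l₀ ^ 2)) := by gcongr
      _ = _ := by ring
  have h2 : s * (c₂ * (1 + c₁ * (1 + l)) * l) ≤ 4 * η₁ * c₂ * (2 + 4 * c₁) * (p * l₀ ^ 2) := by
    have e1 : s ≤ 2 * η₁ * p := hs2.trans (by gcongr; exact hp3.trans hp1)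
    calc s * (c₂ * (1 + c₁ * (1 + l)) * l)
        ≤ 2 * η₁ * p * (c₂ * ((2 + 4 * c₁) * l₀) * (2 * l₀)) := by gcongr
      _ = _ := by ring
  have h3 : T * (c₃ * (1 + c₁ * (1 + l)) * s ^ (1 + α))
      ≤ 2 * c₃ * (2 + 4 * c₁) * (2 * η₁) ^ (1 + α) * (p * l₀ ^ 2) := by
    have e1 : T * s ^ (1 + α) ≤ (2 * η₁) ^ (1 + α) * p := by
      calc T * s ^ (1 + α) ≤ T * (2 * η₁ * (T : ℝ) ^ (-θ)) ^ (1 + α) := by gcongr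
        _ = (2 * η₁) ^ (1 + α) * (T : ℝ) ^ (1 - (1 + α) * θ) := by
            rw [Real.mul_rpow (by positivity) (by positivity), ← Real.rpow_mul hT0.le,
              mul_left_comm, sub_eq_add_neg, Real.rpow_add hT0, Real.rpow_one]
            congr 3
            ring
        _ ≤ _ := by gcongr
    have e2 : 0 ≤ T * s ^ (1 + α) := by positivity
    calc T * (c₃ * (1 + c₁ * (1 + l)) * s ^ (1 + α))
        = c₃ * (1 + c₁ * (1 + l)) * (T * s ^ (1 + α)) := by ring
      _ ≤ c₃ * ((2 + 4 * c₁) * l₀) * ((2 * η₁) ^ (1 + α) * p) := by gcongr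
      _ ≤ c₃ * ((2 + 4 * c₁) * (2 * l₀ ^ 2)) * ((2 * η₁) ^ (1 + α) * p) := by gcongr
      _ = _ := by ring
  have h4 : 0 ≤ p * l₀ ^ 2 := by positivity
  linarith

/-- If the complement of `A` is contained in a set of probability at most `δ`, then `A` has
probability at least `1 - δ`. -/
lemma one_sub_le_measureReal_of_notMem {Ω : Type*} [MeasurableSpace Ω] {P : Measure Ω}
    [IsProbabilityMeasure P] {A B : Set Ω} {δ : ℝ} (hB : P.real B ≤ δ)
    (h : ∀ ω, ω ∉ A → ω ∈ B) : 1 - δ ≤ P.real A := by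
  -- Subadditivity alone is used, so neither set has to be measurable.
  have h1 : A ∪ B = Set.univ := Set.eq_univ_of_forall fun ω ↦ or_iff_not_imp_left.2 (h ω)
  have h2 := measureReal_union_le (μ := P) A B
  rw [h1, probReal_univ] at h2
  linarith

universe u

/-- High probability bound for the last iterate of online gradient descent with polynomially
decaying step sizes. -/
lemma exists_excess_le_of_polyStep {X Y H : Type*} [TopologicalSpace X]
    [SecondCountableTopology X] [MeasurableSpace X] [OpensMeasurableSpace X] [MeasurableSpace Y]
    [NormedAddCommGroup H] [InnerProductSpace ℝ H] [CompleteSpace H] [RKHS ℝ H X ℝ]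
    {ρ : Measure (X × Y)} [IsProbabilityMeasure ρ] {K : X → X → ℝ}
    (hK : Continuous (Function.uncurry K)) (hκ : BddAbove (Set.range fun x : X ↦ √(K x x)))
    (hHK : HasReproducingKernel H K) {φ : Y → ℝ → ℝ} {α L : ℝ} (hφ : IsHolderLoss φ α L)
    (hφm : Measurable (Function.uncurry φ)) {fH : H}
    (hfH : ∀ f : H, genError ρ φ fH ≤ genError ρ φ f)
    (hφ0 : BddAbove (Set.range fun y : Y ↦ φ y 0))
    (hφH : BddAbove (Set.range fun z : X × Y ↦ φ z.2 (fH z.1)))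
    {η₁ : ℝ} (hη₁ : 0 < η₁) (hη₁A : η₁ * (constA α L * kernelBound K ^ 2) ≤ 1)
    {θ : ℝ} (hθ : 1 / 2 < θ) (hθ1 : θ < 1) :
    ∃ C : ℝ, 0 < C ∧
      ∀ (Ω : Type u) [MeasurableSpace Ω] (P : Measure Ω) [IsProbabilityMeasure P]
        (z : ℕ → Ω → X × Y), IsIIDSample P ρ z →
        ∀ T : ℕ, 2 ≤ T → ∀ δ : ℝ, 0 < δ → δ < 1 →
          1 - δ ≤ P.real {ω |
            genError ρ φ (ogd H φ (polyStep η₁ θ) (fun t ↦ z t ω) (T + 1))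
                - genError ρ φ fH
              ≤ C * ((T : ℝ) ^ max (θ - 1) (1 - (1 + α) * θ) * Real.log (T / δ) ^ 2)} := by
  have hk := hHK.continuous_kernelSection hK
  have hκ' : ∀ x, ‖kernelSection H x‖ ≤ kernelBound K := fun x ↦ by
    rw [hHK.norm_kernelSection]
    exact le_ciSup hκ x
  obtain ⟨S, hS⟩ := exists_sum_polyStep_sq_le (η₁ := η₁) hθ
  obtain ⟨c₁, c₂, c₃, hc₁, hc₂, hc₃, hdev⟩ := exists_measureReal_lt_excess_le.{u} hk hφ hφm hκ'
    hφ0 hfH hφH (s := fun n ↦ polyStep η₁ θ (n + 1)) (polyStep_pos hη₁)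
    (antitone_polyStep hη₁ (by linarith)) (by simpa [polyStep] using hη₁A) hS
  have hα := hφ.alpha_pos
  -- The final 1 gives positivity, since the `cᵢ` are only known to be nonnegative.
  refine ⟨16 * c₁ / η₁ + 4 * η₁ * c₂ * (2 + 4 * c₁)
          + 2 * c₃ * (2 + 4 * c₁) * (2 * η₁) ^ (1 + α) + 1, by positivity,
    fun Ω _ P _ z hz T hT δ hδ hδ1 ↦ ?_⟩
  have hT0 : 0 < (T : ℝ) := by positivity
  have hT2 : (2 : ℝ) ≤ T := by exact_mod_cast hT
  -- The level l = log(2T/δ) makes 2T e^(-l) equal to δ; as T ≥ 2, it is at most twice log(T/δ).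
  have hlog2 : Real.log 2 ≤ Real.log (T / δ) := by
    refine Real.log_le_log two_pos ?_
    rw [le_div_iff₀ hδ]
    nlinarith
  have hl : Real.log (2 * T / δ) = Real.log 2 + Real.log (T / δ) := by
    rw [mul_div_assoc, Real.log_mul two_ne_zero (by positivity)]
  have hhalf : 1 / 2 ≤ Real.log (T / δ) := by linarith [Real.log_two_gt_d9]
  have hl0 : 0 ≤ Real.log (2 * T / δ) := by linarith [Real.log_two_gt_d9]
  have hbad := hdev Ω P (fun n ↦ z (n + 1)) (fun n ↦ hz.measurable _ (by omega)) hz.indep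
    (fun n ↦ hz.law _ (by omega)) T (by omega) _ hl0
  have hexp : 2 * T * Real.exp (-Real.log (2 * T / δ)) = δ := by
    rw [Real.exp_neg, Real.exp_log (by positivity)]
    field_simp
  rw [hexp] at hbad
  have hbound := polyStep_deviation_le hc₁ hc₂ hc₃ hη₁ hθ hθ1 hα hT hhalf hl0 (by linarith)
  refine one_sub_le_measureReal_of_notMem hbad fun ω hω ↦ hbound.trans_lt ?_
  simp only [Set.mem_ofPred_eq, not_le, ogd_succ_eq_ogdIter] at hω
  exact hω

theorem corollary1 {d : ℕ} {X : Set (EuclideanSpace ℝ (Fin d))} {Y : Set ℝ}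
    (ρ : Measure (X × Y)) [IsProbabilityMeasure ρ]
    (K : X → X → ℝ) (hK : IsMercerKernel K)
    (hκ : BddAbove (Set.range fun x : X => √(K x x)))
    {H : Type*} [NormedAddCommGroup H] [InnerProductSpace ℝ H] [CompleteSpace H]
    [RKHS ℝ H X ℝ] (hHK : HasReproducingKernel H K)
    (φ : Y → ℝ → ℝ) (α L : ℝ) (hφ : IsHolderLoss φ α L)
    (hφm : Measurable (Function.uncurry φ))
    (fH : H) (hfH : ∀ f : H, genError ρ φ fH ≤ genError ρ φ f)
    (hφ0 : BddAbove (Set.range fun y : Y => φ y 0))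
    (hφH : BddAbove (Set.range fun z : X × Y => φ z.2 (fH z.1)))
    (η₁ : ℝ) (hη₁ : 0 < η₁) (hη₁A : η₁ * (constA α L * kernelBound K ^ 2) ≤ 1) :
    (∀ θ : ℝ, 1 / 2 < θ → θ < 1 →
      ∃ C : ℝ, 0 < C ∧
        ∀ (Ω : Type*) [MeasurableSpace Ω] (P : Measure Ω) [IsProbabilityMeasure P]
          (z : ℕ → Ω → X × Y), IsIIDSample P ρ z →
          ∀ T : ℕ, 2 ≤ T → ∀ δ : ℝ, 0 < δ → δ < 1 →
            1 - δ ≤ P.real {ω |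
              genError ρ φ (ogd H φ (polyStep η₁ θ) (fun t => z t ω) (T + 1))
                  - genError ρ φ fH
                ≤ C * ((T : ℝ) ^ max (θ - 1) (1 - (1 + α) * θ) * Real.log (T / δ) ^ 2)}) ∧
    (∃ C : ℝ, 0 < C ∧
      ∀ (Ω : Type*) [MeasurableSpace Ω] (P : Measure Ω) [IsProbabilityMeasure P]
        (z : ℕ → Ω → X × Y), IsIIDSample P ρ z →
        ∀ T : ℕ, 2 ≤ T → ∀ δ : ℝ, 0 < δ → δ < 1 →
          1 - δ ≤ P.real {ω |
            genError ρ φ (ogd H φ (polyStep η₁ (2 / (2 + α))) (fun t => z t ω) (T + 1))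
                - genError ρ φ fH
              ≤ C * ((T : ℝ) ^ (-(α / (2 + α))) * Real.log (T / δ) ^ 2)}) := by
  refine ⟨fun θ hθ hθ1 ↦ exists_excess_le_of_polyStep hK.continuous hκ hHK hφ hφm hfH hφ0 hφH
    hη₁ hη₁A hθ hθ1, ?_⟩
  have hα := hφ.alpha_pos
  have hα1 := hφ.alpha_le_one
  have hθ : 1 / 2 < 2 / (2 + α) := by
    rw [div_lt_div_iff₀ two_pos (by linarith)]
    linarith
  have hθ1 : 2 / (2 + α) < 1 := by
    rw [div_lt_one (by linarith)]
    linarith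
  -- This θ balances the two exponents.
  have e : max (2 / (2 + α) - 1) (1 - (1 + α) * (2 / (2 + α))) = -(α / (2 + α)) := by
    have e1 : 2 / (2 + α) - 1 = -(α / (2 + α)) := by field_simp; ring
    have e2 : 1 - (1 + α) * (2 / (2 + α)) = -(α / (2 + α)) := by field_simp; ring
    rw [e1, e2, max_self]
  have := exists_excess_le_of_polyStep hK.continuous hκ hHK hφ hφm hfH hφ0 hφH hη₁ hη₁A hθ hθ1
  rw [e] at this
  exact this
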